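/- **Setting.** All rings are commutative with $1$. Let $A$ be a ring and let $\mathbb S$ be the standard ring scheme over $A$, $\mathbb S(R)=R$. A *finite free $\mathbb S$-algebra scheme* $\mathcal E$ over $A$ is a ring scheme over $A$ together with a morphism of ring schemes $s_{\mathcal E}:\mathbb S\to\mathcal E$ and an isomorphism of $\mathbb S$-module schemes $\psi_{\mathcal E}:\mathcal E\to\mathbb S^{\ell}$ for some $\ell\in\mathbb N$. A *morphism of $\mathbb S$-algebra schemes* is a morphism of ring schemes $\alpha:\mathcal E\to\mathcal F$ with $\alpha\circ s_{\mathcal E}=s_{\mathcal F}$. Let $k$ be an $A$-algebra and $e:k\to\mathcal E(k)$ a homomorphism of $A$-algebras, where $\mathcal E(k)$ is an $A$-algebra through $s_{\mathcal E}$. Write $\mathcal E^e(R)$ for the ring $\mathcal E(R)$ regarded as a $k$-algebra through $e$ (for $R$ a $k$-algebra). *Prolongations.* For a scheme $X$ over $k$, the prolongation space $\tau(X)=\tau(X,\mathcal E,e)$ is the Weil restriction of $X\times_k\mathcal E^e(k)$ along $s_{\mathcal E}:k\to\mathcal E(k)$, i.e. the scheme over $k$ representing $T\mapsto \operatorname{Hom}_{\mathcal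 E(k)}(T\times_k\mathcal E(k),X\times_k\mathcal E^e(k))$; in particular $\tau(X)(R)=X(\mathcal E^e(R))$. For $p\in\tau(X)(T)$ let $\hat p:T\times_k\mathcal E(k)\to X$ be the corresponding morphism (over $k$ through $e$), and let $r^X:\tau(X)\times_k\mathcal E(k)\to X$ be the canonical morphism, corresponding to the identity. For $g:X\to Y$, $\tau(g)$ is the Weil restriction of $g\times_k\mathcal E^e(k)$. It is a standing assumption that all the prolongation spaces that occur below exist. *Jet spaces.* Let $m\in\mathbb N$, let $\mathcal I$ be the kernel of multiplication $\mathcal O_X\otimes_k\mathcal O_X\to\mathcal O_X$ and let $\mathit{coJ}_X=\mathcal I/\mathcal I^{m+1}$, an $\mathcal O_X$-module through the left factor. The jet space $\operatorname{Jet}^m(X)=\operatorname{Spec}\operatorname{Sym}^*(\mathit{coJ}_X)$ over $X$ represents $(p:T\to X)\mapsto\operatorname{Hom}_{\mathcal O_T}(p^*\mathit{coJ}_X,\mathcal O_T)$, so that its $T$-points are the pairs $(p,\nu)$ with $p\in X(T)$ and $\nu:p^*\mathit{coJ}_X\to\mathcal O_T$. It is functorial in $X$: $\operatorname{Jet}^m(g)(p,\nu)=(g\circ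 p,\nu\circ dg)$, where $dg$ is induced by $a\otimes b\mapsto g^*a\otimes g^*b$. *The interpolating map.* $\phi^X=\phi^X_{\mathcal E,e}:\operatorname{Jet}^m(\tau(X))\to\tau(\operatorname{Jet}^m(X))$ is the morphism sending a point $(p,\nu)$ with values in $T$ to the point corresponding to $(\hat p,v(u(\nu)))$, where $u(\nu)=\nu\otimes_k\mathcal E(k)$ is the base change of $\nu$, a homomorphism from the pullback of the co-jets of $\tau(X)\times_k\mathcal E(k)$ over $\mathcal E(k)$ to the structure sheaf of $T\times_k\mathcal E(k)$, and where $v$ is composition with the map $\hat p^*\mathit{coJ}_X\to (p\times_k\mathcal E(k))^*\mathit{coJ}_{\tau(X)\times_k\mathcal E(k)}$ induced by $r^X$. *Composition and comparison.* If $\mathcal F$ is another finite free $\mathbb S$-algebra scheme over $A$ and $f:k\to\mathcal F(k)$ is a homomorphism of $A$-algebras, then $\mathcal E\mathcal F$ is the finite free $\mathbb S$-algebra scheme $R\mapsto\mathcal E(\mathcal F(R))$ with $s_{\mathcal E\mathcal F}=s_{\mathcal E}\circ s_{\mathcal F}$ and the composite isomorphism with $\mathbb S^{\ell_{\mathcal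 E}\ell_{\mathcal F}}$, and $ef=\mathcal E(f)\circ e:k\to\mathcal E\mathcal F(k)$. There is a canonical morphism $\theta^X:\tau(\tau(X,\mathcal E,e),\mathcal F,f)\to\tau(X,\mathcal E\mathcal F,ef)$, whose corresponding morphism to $X$ is the composite of $r^{\tau(X,\mathcal E,e)}_{\mathcal F,f}$ (base changed to $\mathcal E\mathcal F(k)$) and $r^X_{\mathcal E,e}$. If $\alpha:\mathcal E\to\mathcal F$ is a morphism of $\mathbb S$-algebra schemes with $\alpha^k\circ e=f$, then $\hat\alpha^X:\tau(X,\mathcal E,e)\to\tau(X,\mathcal F,f)$ is the morphism given on points by composition with $\alpha:\mathcal E^e(R)\to\mathcal F^f(R)$. **Proposition.** Let $\mathcal E$, $k$, $e$ and $m$ be as above. (a) *(Functoriality.)* For every morphism $g:X\to Y$ of schemes over $k$, $$\tau(\operatorname{Jet}^m(g))\circ\phi^X=\phi^Y\circ\operatorname{Jet}^m(\tau(g)).$$ (b) *(Composition of prolongations.)* For every finite free $\mathbb S$-algebra scheme $\mathcal F$ over $A$, every homomorphism of $A$-algebras $f:k\to\mathcal F(k)$ and every scheme $X$ over $k$, the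 canonical morphisms $\theta^X$ and $\theta^{\operatorname{Jet}^m(X)}$ are isomorphisms, and, with $\tau(\tau(-,\mathcal E,e),\mathcal F,f)$ identified with $\tau(-,\mathcal E\mathcal F,ef)$ through them, $$\phi^X_{\mathcal E\mathcal F,ef}=\tau(\phi^X_{\mathcal E,e},\mathcal F,f)\circ\phi^{\tau(X,\mathcal E,e)}_{\mathcal F,f},$$ that is, $\phi^X_{\mathcal E\mathcal F,ef}\circ\operatorname{Jet}^m(\theta^X)=\theta^{\operatorname{Jet}^m(X)}\circ\tau(\phi^X_{\mathcal E,e},\mathcal F,f)\circ\phi^{\tau(X,\mathcal E,e)}_{\mathcal F,f}$. (c) *(Comparison of prolongations.)* For every finite free $\mathbb S$-algebra scheme $\mathcal F$ over $A$, every homomorphism of $A$-algebras $f:k\to\mathcal F(k)$, every morphism of $\mathbb S$-algebra schemes $\alpha:\mathcal E\to\mathcal F$ with $\alpha^k\circ e=f$ and every scheme $X$ over $k$, $$\phi^X_{\mathcal F,f}\circ\operatorname{Jet}^m(\hat\alpha^X)=\hat\alpha^{\operatorname{Jet}^m(X)}\circ\phi^X_{\mathcal E,e}.$$ -/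

import Mathlib

open CategoryTheory Limits AlgebraicGeometry TensorProduct

universe u

namespace Jets

section Algebra

variable (m : ℕ) (k C : Type u) [CommRing k] [CommRing C] [Algebra k C]

/-- The ring `(C ⊗ C) / I ^ (m + 1)`, where `I` is the kernel of the multiplication
`C ⊗[k] C → C`. -/
abbrev PrincipalParts : Type u := (C ⊗[k] C) ⧸ (KaehlerDifferential.ideal k C) ^ (m + 1)

/-- The ideal `I / I ^ (m + 1)` of `(C ⊗ C) / I ^ (m + 1)`. -/
noncomputable def coJetIdeal : Ideal (PrincipalParts m k C) :=
  (KaehlerDifferential.ideal k C).map (Ideal.Quotient.mk _)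

/-- The `m`-th co-jets `I / I ^ (m + 1)` of the `k`-algebra `C`; it is a `C`-module through
multiplication on the left factor of `C ⊗[k] C`. -/
abbrev CoJet : Type u := coJetIdeal m k C

variable {k C}
variable {k' C' : Type u} [CommRing k'] [CommRing C'] [Algebra k' C']

/-- `C ⊗[k] C → C' ⊗[k'] C'`, `a ⊗ b ↦ φ a ⊗ φ b`, for a ring homomorphism `φ` over `σ`. -/
noncomputable def tensorMap (σ : k →+* k') (φ : C →+* C')
    (h : φ.comp (algebraMap k C) = (algebraMap k' C').comp σ) : C ⊗[k] C →+* C' ⊗[k'] C' :=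
  letI : Algebra k (C' ⊗[k'] C') := ((algebraMap k' (C' ⊗[k'] C')).comp σ).toAlgebra
  (Algebra.TensorProduct.lift
    ({ (Algebra.TensorProduct.includeLeftRingHom (R := k') (A := C') (B := C')).comp φ with
        commutes' := fun a => congrArg
          (Algebra.TensorProduct.includeLeftRingHom (R := k') (A := C') (B := C'))
          (RingHom.congr_fun h a) } : C →ₐ[k] C' ⊗[k'] C')
    ({ (Algebra.TensorProduct.includeRight (R := k') (A := C') (B := C')).toRingHom.comp φ with
        commutes' := fun a => (congrArg
          (Algebra.TensorProduct.includeRight (R := k') (A := C') (B := C'))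
          (RingHom.congr_fun h a)).trans
            ((Algebra.TensorProduct.includeRight (R := k') (A := C') (B := C')).commutes (σ a)) } :
      C →ₐ[k] C' ⊗[k'] C')
    (fun _ _ => Commute.all _ _)).toRingHom

@[simp]
theorem tensorMap_tmul (σ : k →+* k') (φ : C →+* C')
    (h : φ.comp (algebraMap k C) = (algebraMap k' C').comp σ) (a b : C) :
    tensorMap σ φ h (a ⊗ₜ b) = φ a ⊗ₜ φ b := by
  simp [tensorMap]

theorem tensorMap_ideal (σ : k →+* k') (φ : C →+* C')
    (h : φ.comp (algebraMap k C) = (algebraMap k' C').comp σ) :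
    (KaehlerDifferential.ideal k C).map (tensorMap σ φ h) ≤ KaehlerDifferential.ideal k' C' := by
  rw [← KaehlerDifferential.span_range_eq_ideal, Ideal.map_span, Ideal.span_le]
  rintro _ ⟨_, ⟨s, rfl⟩, rfl⟩
  simp [RingHom.mem_ker]

/-- The map induced on principal parts. -/
noncomputable def PrincipalParts.map (σ : k →+* k') (φ : C →+* C')
    (h : φ.comp (algebraMap k C) = (algebraMap k' C').comp σ) :
    PrincipalParts m k C →+* PrincipalParts m k' C' :=
  Ideal.quotientMap _ (tensorMap σ φ h) (by
    rw [← Ideal.map_le_iff_le_comap, Ideal.map_pow]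
    exact Ideal.pow_right_mono (tensorMap_ideal σ φ h) _)

theorem PrincipalParts.map_mem (σ : k →+* k') (φ : C →+* C')
    (h : φ.comp (algebraMap k C) = (algebraMap k' C').comp σ) {x : PrincipalParts m k C}
    (hx : x ∈ coJetIdeal m k C) : PrincipalParts.map m σ φ h x ∈ coJetIdeal m k' C' := by
  suffices h' : (coJetIdeal m k C).map (PrincipalParts.map m σ φ h) ≤ coJetIdeal m k' C' from
    h' (Ideal.mem_map_of_mem _ hx)
  rw [coJetIdeal, Ideal.map_map]
  have : (PrincipalParts.map m σ φ h).comp (Ideal.Quotient.mk _) =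
    (Ideal.Quotient.mk _).comp (tensorMap σ φ h) := by
      refine RingHom.ext fun x => rfl
  rw [this, ← Ideal.map_map]
  exact Ideal.map_mono (tensorMap_ideal σ φ h)

/-- The map induced on co-jets by a ring homomorphism `φ : C → C'` over `σ : k → k'`, namely
`a ⊗ b ↦ φ a ⊗ φ b`. -/
noncomputable def CoJet.map (σ : k →+* k') (φ : C →+* C')
    (h : φ.comp (algebraMap k C) = (algebraMap k' C').comp σ) : CoJet m k C →+ CoJet m k' C' where
  toFun x := ⟨PrincipalParts.map m σ φ h x.1, PrincipalParts.map_mem m σ φ h x.2⟩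
  map_zero' := Subtype.ext (map_zero _)
  map_add' x y := Subtype.ext (map_add _ x.1 y.1)


/-- Unique lifting along nilpotent ideals for the square `k → C`, `k' → C'`: this says that
`C'` is formally étale over `C ⊗[k] k'`. -/
def LiftsUniquely (σ : k →+* k') (φ : C →+* C') : Prop :=
  ∀ (Q : Type u) [CommRing Q] (N : Ideal Q) (_ : IsNilpotent N) (f : C →+* Q) (g : k' →+* Q)
    (t : C' →+* Q ⧸ N), f.comp (algebraMap k C) = g.comp σ →
    t.comp φ = (Ideal.Quotient.mk N).comp f →
    t.comp (algebraMap k' C') = (Ideal.Quotient.mk N).comp g →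
    ∃! l : C' →+* Q, l.comp φ = f ∧ l.comp (algebraMap k' C') = g ∧
      (Ideal.Quotient.mk N).comp l = t

theorem coJetIdeal_pow : coJetIdeal m k C ^ (m + 1) = ⊥ := by
  rw [coJetIdeal, ← Ideal.map_pow, Ideal.map_quotient_self]

theorem sub_mem_coJetIdeal (c : C) :
    (Ideal.Quotient.mk _ (1 ⊗ₜ c - c ⊗ₜ 1) : PrincipalParts m k C) ∈ coJetIdeal m k C :=
  Ideal.mem_map_of_mem _ (by simp [RingHom.mem_ker])

variable (k C) in
/-- The inclusion of the right factor. -/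
noncomputable def PrincipalParts.right : C →+* PrincipalParts m k C :=
  (Ideal.Quotient.mk _).comp
    (Algebra.TensorProduct.includeRight (R := k) (A := C) (B := C)).toRingHom

variable (k C) in
/-- The augmentation. -/
noncomputable def PrincipalParts.aug : PrincipalParts m k C →ₐ[C] C :=
  Ideal.Quotient.liftₐ _ (Algebra.TensorProduct.lmul'' k) (by
    intro a ha
    have := Ideal.pow_le_self (Nat.succ_ne_zero m) ha
    simpa [RingHom.mem_ker] using! this)

theorem PrincipalParts.aug_eq_zero {x : PrincipalParts m k C} (hx : x ∈ coJetIdeal m k C) :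
    PrincipalParts.aug m k C x = 0 := by
  suffices h : coJetIdeal m k C ≤ RingHom.ker (PrincipalParts.aug m k C) from h hx
  rw [coJetIdeal, Ideal.map_le_iff_le_comap]
  intro a ha
  simpa [RingHom.mem_ker, PrincipalParts.aug] using! ha

theorem PrincipalParts.sub_aug_mem (x : PrincipalParts m k C) :
    x - algebraMap C _ (PrincipalParts.aug m k C x) ∈ coJetIdeal m k C := by
  obtain ⟨x, rfl⟩ := Ideal.Quotient.mk_surjective x
  have : (Ideal.Quotient.mk _ (x - algebraMap C _ (Algebra.TensorProduct.lmul' k x)) :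
      PrincipalParts m k C) ∈ coJetIdeal m k C :=
    Ideal.mem_map_of_mem _ (by simp [RingHom.mem_ker, Algebra.TensorProduct.algebraMap_apply])
  simpa using! this

theorem PrincipalParts.hom_ext {Q : Type u} [CommRing Q] {f g : PrincipalParts m k C →+* Q}
    (h₁ : f.comp (algebraMap C _) = g.comp (algebraMap C _))
    (h₂ : f.comp (PrincipalParts.right m k C) = g.comp (PrincipalParts.right m k C)) : f = g := by
  refine Ideal.Quotient.ringHom_ext (RingHom.ext fun x => ?_)
  induction x with
  | zero => simp
  | add x y hx hy => rw [map_add, map_add, hx, hy]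
  | tmul a b =>
    have : (a ⊗ₜ[k] b : C ⊗[k] C) = a ⊗ₜ 1 * 1 ⊗ₜ b := by simp
    rw [this, map_mul, map_mul]
    exact congrArg₂ (· * ·) (RingHom.congr_fun h₁ a) (RingHom.congr_fun h₂ b)


theorem PrincipalParts.right_sub_mem (c : C) :
    PrincipalParts.right m k C c - algebraMap C _ c ∈ coJetIdeal m k C := by
  simpa using! sub_mem_coJetIdeal (k := k) m c

theorem PrincipalParts.right_algebraMap (a : k) :
    PrincipalParts.right m k C (algebraMap k C a) = algebraMap C _ (algebraMap k C a) :=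
  congrArg (Ideal.Quotient.mk _)
    ((Algebra.TensorProduct.includeRight (R := k) (A := C) (B := C)).commutes a)

theorem PrincipalParts.map_comp_algebraMap (σ : k →+* k') (φ : C →+* C')
    (h : φ.comp (algebraMap k C) = (algebraMap k' C').comp σ) :
    (PrincipalParts.map m σ φ h).comp (algebraMap C _) = (algebraMap C' _).comp φ := by
  refine RingHom.ext fun c => ?_
  refine congrArg (Ideal.Quotient.mk _) (?_ : tensorMap σ φ h (c ⊗ₜ 1) = φ c ⊗ₜ 1)
  simp

theorem PrincipalParts.map_comp_right (σ : k →+* k') (φ : C →+* C')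
    (h : φ.comp (algebraMap k C) = (algebraMap k' C').comp σ) :
    (PrincipalParts.map m σ φ h).comp (PrincipalParts.right m k C) =
      (PrincipalParts.right m k' C').comp φ := by
  refine RingHom.ext fun c => ?_
  refine congrArg (Ideal.Quotient.mk _) (?_ : tensorMap σ φ h (1 ⊗ₜ c) = 1 ⊗ₜ φ c)
  simp

theorem CoJet.existsUnique_extend_aux (σ : k →+* k') (φ : C →+* C')
    (h : φ.comp (algebraMap k C) = (algebraMap k' C').comp σ) (H : LiftsUniquely σ φ)
    {R : Type u} [CommRing R] (ψ : C' →+* R) (lam : CoJet m k C →+ R)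
    (Q : Type u) [CommRing Q] (iL : C' →+* Q) (iR : PrincipalParts m k C →+* Q)
    (hi : iR.comp (algebraMap C _) = iL.comp φ)
    (Lam : Q →+ R) (hLam : ∀ d q, Lam (iL d * q) = ψ d * Lam q)
    (hLam' : ∀ x : CoJet m k C, Lam (iR x) = lam x)
    (Psi : Q →+* PrincipalParts m k' C') (hPsi : Psi.comp iL = algebraMap C' _)
    (hPsi' : Psi.comp iR = PrincipalParts.map m σ φ h)
    (hQ : ∀ (p : Q → Prop), (∀ d x, p (iL d * iR x)) → (∀ x y, p x → p y → p (x + y)) → ∀ x, p x) :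
    ∃! μ : CoJet m k' C' →+ R, (∀ (a : C') x, μ (a • x) = ψ a * μ x) ∧
      ∀ x, μ (CoJet.map m σ φ h x) = lam x := by
  let N : Ideal Q := (coJetIdeal m k C).map iR
  have hN : IsNilpotent N := ⟨m + 1, by
    rw [← Ideal.map_pow, coJetIdeal_pow, Ideal.map_bot]; rfl⟩
  obtain ⟨l, ⟨hl₁, hl₂, hl₃⟩, -⟩ := H Q N hN (iR.comp (PrincipalParts.right m k C))
    (iL.comp (algebraMap k' C')) ((Ideal.Quotient.mk N).comp iL)
    (by
      refine RingHom.ext fun a => ?_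
      have := RingHom.congr_fun hi (algebraMap k C a)
      simp only [RingHom.comp_apply] at this ⊢
      rw [PrincipalParts.right_algebraMap, this, ← RingHom.comp_apply φ, h]; rfl)
    (by
      refine RingHom.ext fun c => ?_
      have := RingHom.congr_fun hi c
      simp only [RingHom.comp_apply] at this ⊢
      rw [← this, eq_comm, Ideal.Quotient.eq, ← map_sub]
      exact Ideal.mem_map_of_mem _ (PrincipalParts.right_sub_mem m c))
    rfl
  have hl₃' (d : C') : l d - iL d ∈ N := by
    rw [← Ideal.Quotient.eq]; exact RingHom.congr_fun hl₃ d
  have hlk (a : k') : l (algebraMap k' C' a) = iL (algebraMap k' C' a) := RingHom.congr_fun hl₂ a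
  -- the ring homomorphism `C' ⊗ C' → Q`
  let _ : Algebra k' Q := (iL.comp (algebraMap k' C')).toAlgebra
  let T : C' ⊗[k'] C' →ₐ[k'] Q := Algebra.TensorProduct.lift
    ({ iL with commutes' := fun a => rfl } : C' →ₐ[k'] Q)
    ({ l with commutes' := fun a => hlk a } : C' →ₐ[k'] Q) (fun _ _ => Commute.all _ _)
  have hT (a b : C') : T (a ⊗ₜ b) = iL a * l b := Algebra.TensorProduct.lift_tmul _ _ _ _ _
  have hTN : (KaehlerDifferential.ideal k' C').map T.toRingHom ≤ N := by
    rw [← KaehlerDifferential.span_range_eq_ideal, Ideal.map_span, Ideal.span_le]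
    rintro _ ⟨_, ⟨s, rfl⟩, rfl⟩
    change T _ ∈ N
    rw [map_sub, hT, hT, map_one, map_one, one_mul, mul_one]
    exact hl₃' s
  let Θ : PrincipalParts m k' C' →+* Q := Ideal.Quotient.lift _ T.toRingHom (by
    intro a ha
    have h1 : T.toRingHom a ∈ ((KaehlerDifferential.ideal k' C').map T.toRingHom) ^ (m + 1) := by
      rw [← Ideal.map_pow]; exact Ideal.mem_map_of_mem _ ha
    have h2 := Ideal.pow_right_mono hTN (m + 1) h1
    rw [← Ideal.map_pow, coJetIdeal_pow, Ideal.map_bot] at h2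
    simpa using h2)
  have hΘL (d : C') : Θ (algebraMap C' _ d) = iL d := by
    change T (d ⊗ₜ 1) = _
    rw [hT, map_one, mul_one]
  have hΘR (d : C') : Θ (PrincipalParts.right m k' C' d) = l d := by
    change T (1 ⊗ₜ d) = _
    rw [hT, map_one, one_mul]
  have hΘN {x} (hx : x ∈ coJetIdeal m k' C') : Θ x ∈ N := by
    have : coJetIdeal m k' C' ≤ N.comap Θ := by
      rw [coJetIdeal, Ideal.map_le_iff_le_comap]
      intro a ha
      exact hTN (Ideal.mem_map_of_mem _ ha)
    exact this hx
  have hΘmap : Θ.comp (PrincipalParts.map m σ φ h) = iR := by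
    apply PrincipalParts.hom_ext
    · rw [RingHom.comp_assoc, PrincipalParts.map_comp_algebraMap, hi]
      exact RingHom.ext fun c => hΘL _
    · rw [RingHom.comp_assoc, PrincipalParts.map_comp_right, ← hl₁]
      exact RingHom.ext fun c => hΘR _
  have hPsiN : N ≤ (coJetIdeal m k' C').comap Psi := by
    rw [Ideal.map_le_iff_le_comap]
    intro x hx
    change (Psi.comp iR) x ∈ coJetIdeal m k' C'
    rw [hPsi']
    exact PrincipalParts.map_mem m σ φ h hx
  have hPsiΘ : Psi.comp Θ = RingHom.id _ := by
    apply PrincipalParts.hom_ext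
    · refine RingHom.ext fun c => ?_
      change Psi (Θ (algebraMap C' _ c)) = algebraMap C' _ c
      rw [hΘL]; exact RingHom.congr_fun hPsi c
    · have hn : IsNilpotent (coJetIdeal m k' C') := ⟨m + 1, coJetIdeal_pow m⟩
      refine (H _ (coJetIdeal m k' C') hn ((PrincipalParts.right m k' C').comp φ)
        ((PrincipalParts.right m k' C').comp (algebraMap k' C'))
        ((Ideal.Quotient.mk _).comp (PrincipalParts.right m k' C')) ?_ rfl rfl).unique ?_
          ⟨rfl, rfl, rfl⟩
      · rw [RingHom.comp_assoc, h]; rfl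
      · refine ⟨?_, ?_, ?_⟩
        · refine RingHom.ext fun c => ?_
          have h1 := RingHom.congr_fun hl₁ c
          have h2 := RingHom.congr_fun hPsi' (PrincipalParts.right m k C c)
          have h3 := RingHom.congr_fun (PrincipalParts.map_comp_right m σ φ h) c
          simp only [RingHom.comp_apply] at h1 h2 h3 ⊢
          rw [hΘR, h1, h2, h3]
        · refine RingHom.ext fun c => ?_
          have h2 := RingHom.congr_fun hPsi (algebraMap k' C' c)
          simp only [RingHom.comp_apply] at h2 ⊢
          rw [hΘR, hlk, h2, PrincipalParts.right_algebraMap]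
        · refine RingHom.ext fun c => ?_
          simp only [RingHom.comp_apply]
          rw [hΘR, Ideal.Quotient.eq]
          have h2 := RingHom.congr_fun hPsi c
          have h4 := hPsiN (hl₃' c)
          simp only [RingHom.comp_apply, Ideal.mem_comap, map_sub] at h2 h4
          rw [h2] at h4
          have h5 := PrincipalParts.right_sub_mem (k := k') m c
          have := sub_mem h4 h5
          simpa using this
  refine existsUnique_of_exists_of_unique
    ⟨(Lam.comp Θ.toAddMonoidHom).comp (coJetIdeal m k' C').toAddSubgroup.subtype, ⟨?_, ?_⟩⟩ ?_
  · intro a x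
    change Lam (Θ ((a • x : CoJet m k' C') : PrincipalParts m k' C')) = ψ a * Lam (Θ x)
    rw [← hLam, ← hΘL, ← map_mul]
    congr 2
    exact Algebra.smul_def _ _
  · intro x
    change Lam (Θ (PrincipalParts.map m σ φ h x)) = lam x
    rw [← hLam', ← hΘmap]; rfl
  · rintro μ ν ⟨hμ₁, hμ₂⟩ ⟨hν₁, hν₂⟩
    have key (q : Q) (z : CoJet m k C) (hq : Psi (q * iR z) ∈ coJetIdeal m k' C') :
        μ ⟨Psi (q * iR z), hq⟩ = ν ⟨Psi (q * iR z), hq⟩ := by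
      have hz (q : Q) : Psi (q * iR z) ∈ coJetIdeal m k' C' :=
        hPsiN (N.mul_mem_left _ (Ideal.mem_map_of_mem _ z.2))
      refine hQ (fun q => ∀ hq : Psi (q * iR z) ∈ coJetIdeal m k' C',
        μ ⟨Psi (q * iR z), hq⟩ = ν ⟨Psi (q * iR z), hq⟩) ?_ ?_ q hq
      · intro d x hq
        have : (⟨Psi (iL d * iR x * iR z), hq⟩ : CoJet m k' C') =
            d • CoJet.map m σ φ h (x • z) := by
          ext
          change Psi _ = d • PrincipalParts.map m σ φ h (x * z)
          rw [mul_assoc, ← map_mul, map_mul, ← RingHom.comp_apply Psi iL, hPsi, ← hPsi',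
            Algebra.smul_def]
          rfl
        rw [this, hμ₁, hν₁, hμ₂, hν₂]
      · intro x y hx hy hq
        have : (⟨Psi ((x + y) * iR z), hq⟩ : CoJet m k' C') =
            ⟨Psi (x * iR z), hz x⟩ + ⟨Psi (y * iR z), hz y⟩ := by
          ext
          change Psi _ = Psi _ + Psi _
          rw [add_mul, map_add]
        rw [this, map_add, map_add, hx, hy]
    have key' (q : Q) (hq : q ∈ N) : ∀ hq' : Psi q ∈ coJetIdeal m k' C',
        μ ⟨Psi q, hq'⟩ = ν ⟨Psi q, hq'⟩ := by
      refine Submodule.closure_induction (p := fun q _ => ∀ hq' : Psi q ∈ coJetIdeal m k' C',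
        μ ⟨Psi q, hq'⟩ = ν ⟨Psi q, hq'⟩) ?_ ?_ ?_ hq
      · intro hq'
        have : (⟨Psi 0, hq'⟩ : CoJet m k' C') = 0 := Subtype.ext (map_zero Psi)
        rw [this, map_zero, map_zero]
      · intro x y hx hy hx' hy' hq'
        have : (⟨Psi (x + y), hq'⟩ : CoJet m k' C') =
            ⟨Psi x, hPsiN hx⟩ + ⟨Psi y, hPsiN hy⟩ := Subtype.ext (map_add Psi x y)
        rw [this, map_add, map_add]
        exact congrArg₂ (· + ·) (hx' _) (hy' _)
      · rintro r _ ⟨z, hz, rfl⟩ hq'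
        exact key r ⟨z, hz⟩ hq'
    ext x
    have hx : Psi (Θ x) = x := RingHom.congr_fun hPsiΘ x
    have hx' : Psi (Θ x) ∈ coJetIdeal m k' C' := by rw [hx]; exact x.2
    have h1 := key' (Θ x) (hΘN x.2) hx'
    have h2 : (⟨Psi (Θ x), hx'⟩ : CoJet m k' C') = x := Subtype.ext hx
    rwa [h2] at h1

theorem exists_tensorDesc {D P S : Type u} [CommRing D] [CommRing P] [CommRing S] [Algebra C D]
    [Algebra C P] (f : D →+* S) (g : P →+* S)
    (h : f.comp (algebraMap C D) = g.comp (algebraMap C P)) :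
    ∃ F : D ⊗[C] P →+* S, ∀ d p, F (d ⊗ₜ p) = f d * g p := by
  let _ : Algebra C S := (f.comp (algebraMap C D)).toAlgebra
  exact ⟨(Algebra.TensorProduct.lift ({ f with commutes' := fun a => rfl } : D →ₐ[C] S)
    ({ g with commutes' := fun a => (RingHom.congr_fun h a).symm } : P →ₐ[C] S)
    (fun _ _ => Commute.all _ _)).toRingHom, fun _ _ => Algebra.TensorProduct.lift_tmul _ _ _ _ _⟩

theorem CoJet.existsUnique_extend (σ : k →+* k') (φ : C →+* C')
    (h : φ.comp (algebraMap k C) = (algebraMap k' C').comp σ) (H : LiftsUniquely σ φ)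
    {R : Type u} [CommRing R] (ψ : C' →+* R) (lam : CoJet m k C →+ R)
    (hlam : ∀ (a : C) x, lam (a • x) = ψ (φ a) * lam x) :
    ∃! μ : CoJet m k' C' →+ R, (∀ (a : C') x, μ (a • x) = ψ a * μ x) ∧
      ∀ x, μ (CoJet.map m σ φ h x) = lam x := by
  let _ : Algebra C C' := φ.toAlgebra
  let _ : Algebra C' R := ψ.toAlgebra
  let _ : Algebra C R := (ψ.comp φ).toAlgebra
  have _ : IsScalarTower C C' R := .of_algebraMap_eq fun _ => rfl
  -- extend `lam` by zero on constants
  let lam' : PrincipalParts m k C →ₗ[C] R :=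
    { toFun := fun x => lam ⟨x - algebraMap C _ (PrincipalParts.aug m k C x),
        PrincipalParts.sub_aug_mem m x⟩
      map_add' := fun x y => by
        rw [← map_add]; congr 1; ext
        change x + y - algebraMap C _ (PrincipalParts.aug m k C (x + y)) = (_ - _) + (_ - _)
        rw [map_add, map_add]; ring
      map_smul' := fun c x => by
        have : (⟨c • x - algebraMap C _ (PrincipalParts.aug m k C (c • x)),
            PrincipalParts.sub_aug_mem m _⟩ : CoJet m k C) =
            c • ⟨x - algebraMap C _ (PrincipalParts.aug m k C x),
              PrincipalParts.sub_aug_mem m x⟩ := by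
          ext
          change c • x - algebraMap C _ (PrincipalParts.aug m k C (c • x)) = c • (_ - _)
          rw [map_smul, smul_sub, smul_eq_mul, map_mul, Algebra.smul_def c (algebraMap C _ _)]
        rw [this, hlam]; rfl }
  have hlam' (x : CoJet m k C) : lam' x = lam x := by
    change lam _ = _
    congr 1; ext
    change (x : PrincipalParts m k C) - _ = x
    rw [PrincipalParts.aug_eq_zero m x.2, map_zero, sub_zero]
  let Lam : C' ⊗[C] PrincipalParts m k C →ₗ[C'] R :=
    TensorProduct.AlgebraTensorModule.lift
      ((LinearMap.lsmul C' (PrincipalParts m k C →ₗ[C] R)).flip lam')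
  have hLam (d : C') (x) : Lam (d ⊗ₜ x) = ψ d * lam' x := rfl
  obtain ⟨Psi, hPsi⟩ := exists_tensorDesc (algebraMap C' (PrincipalParts m k' C'))
    (PrincipalParts.map m σ φ h) (PrincipalParts.map_comp_algebraMap m σ φ h).symm
  refine CoJet.existsUnique_extend_aux m σ φ h H ψ lam (C' ⊗[C] PrincipalParts m k C)
    (algebraMap C' _) (Algebra.TensorProduct.includeRight
      (R := C) (A := C') (B := PrincipalParts m k C)).toRingHom ?_ Lam.toAddMonoidHom ?_ ?_ Psi ?_ ?_ ?_
  · refine RingHom.ext fun c => ?_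
    change (1 : C') ⊗ₜ[C] (algebraMap C _ c) = (φ c) ⊗ₜ[C] 1
    rw [Algebra.algebraMap_eq_smul_one, TensorProduct.tmul_smul, TensorProduct.smul_tmul']
    congr 1
    simp [Algebra.smul_def, RingHom.algebraMap_toAlgebra]
  · intro d q
    change Lam (algebraMap C' _ d * q) = _
    rw [← Algebra.smul_def, map_smul]
    rfl
  · intro x
    change Lam (1 ⊗ₜ (x : PrincipalParts m k C)) = lam x
    rw [hLam, map_one, one_mul, hlam']
  · refine RingHom.ext fun d => ?_
    change Psi (d ⊗ₜ 1) = _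
    rw [hPsi, map_one, mul_one]
  · refine RingHom.ext fun x => ?_
    change Psi (1 ⊗ₜ x) = _
    rw [hPsi, map_one, one_mul]
  · intro p hp hadd x
    induction x with
    | zero => simpa using hp 0 0
    | add x y hx hy => exact hadd x y hx hy
    | tmul d x =>
      have := hp d x
      have h2 : (d ⊗ₜ[C] x : C' ⊗[C] PrincipalParts m k C) =
        algebraMap C' _ d * (1 : C') ⊗ₜ[C] x := by
          simp [Algebra.TensorProduct.algebraMap_apply]
      rw [h2]; exact this

end Algebra

section Sheaf

variable {K K' : CommRingCat.{u}}

/-- The sections of `𝒪_X` over `U`, as a `K`-algebra, for a scheme `X` over `K`. -/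
def Sections (X : Over (Spec K)) (U : X.left.Opens) : Type u := Γ(X.left, U)

noncomputable instance (X : Over (Spec K)) (U : X.left.Opens) : CommRing (Sections X U) :=
  inferInstanceAs (CommRing Γ(X.left, U))

/-- The structure map `K → 𝒪_X(U)` of a scheme `X` over `K`. -/
noncomputable def structHom (X : Over (Spec K)) (U : X.left.Opens) : K ⟶ Γ(X.left, U) :=
  (Scheme.ΓSpecIso K).inv ≫ X.hom.appLE ⊤ U (show U ≤ X.hom ⁻¹ᵁ ⊤ from le_top)

noncomputable instance (X : Over (Spec K)) (U : X.left.Opens) : Algebra K (Sections X U) :=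
  (structHom X U).hom.toAlgebra

/-- The comorphism `𝒪_X(U) → 𝒪_Z(V)` of `r : Z → X`. -/
noncomputable def Sections.map {X : Over (Spec K)} {Z : Over (Spec K')} (r : Z.left ⟶ X.left)
    {U : X.left.Opens} {V : Z.left.Opens} (h : V ≤ r ⁻¹ᵁ U) : Sections X U →+* Sections Z V :=
  (r.appLE U V h).hom

theorem Sections.map_comp_algebraMap {X : Over (Spec K)} {Z : Over (Spec K')} (σ : K ⟶ K')
    (r : Z.left ⟶ X.left) (hr : r ≫ X.hom = Z.hom ≫ Spec.map σ)
    {U : X.left.Opens} {V : Z.left.Opens} (h : V ≤ r ⁻¹ᵁ U) :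
    (Sections.map r h).comp (algebraMap K (Sections X U)) =
      (algebraMap K' (Sections Z V)).comp σ.hom := by
  have h₁ : U ≤ X.hom ⁻¹ᵁ ⊤ := le_top
  have h₂ : V ≤ Z.hom ⁻¹ᵁ ⊤ := le_top
  have h₃ : V ≤ (r ≫ X.hom) ⁻¹ᵁ ⊤ := le_top
  have h₄ : V ≤ (Z.hom ≫ Spec.map σ) ⁻¹ᵁ ⊤ := le_top
  have h₅ : (⊤ : (Spec K').Opens) ≤ Spec.map σ ⁻¹ᵁ ⊤ := le_top
  suffices H : structHom X U ≫ r.appLE U V h = σ ≫ structHom Z V from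
    congrArg CommRingCat.Hom.hom H
  have e₁ : X.hom.appLE ⊤ U h₁ ≫ r.appLE U V h = (r ≫ X.hom).appLE ⊤ V h₃ :=
    Scheme.Hom.appLE_comp_appLE ..
  have e₂ : (Spec.map σ).appTop ≫ Z.hom.appLE ⊤ V h₂ = (Z.hom ≫ Spec.map σ).appLE ⊤ V h₄ := by
    rw [← Scheme.Hom.appLE_comp_appLE Z.hom (Spec.map σ) ⊤ ⊤ V h₅ h₂]
    congr 1
  rw [structHom, structHom, Category.assoc, e₁, Scheme.ΓSpecIso_inv_naturality_assoc, e₂]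
  congr 2

theorem fromSpec_comp_hom {X : Over (Spec K)} {U : X.left.Opens} (hU : IsAffineOpen U) :
    hU.fromSpec ≫ X.hom = Spec.map (structHom X U) := by
  have h := IsAffineOpen.SpecMap_appLE_fromSpec X.hom (isAffineOpen_top (Spec K)) hU
    (show U ≤ X.hom ⁻¹ᵁ ⊤ from le_top)
  rw [IsAffineOpen.fromSpec_top, Scheme.isoSpec_Spec_inv] at h
  rw [← h, ← Spec.map_comp]
  rfl

/-- On affine opens, a Cartesian square has the unique lifting property. -/
theorem isPullback_liftsUniquely {X : Over (Spec K)} {Z : Over (Spec K')} {σ : K ⟶ K'}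
    {r : Z.left ⟶ X.left} (hr : IsPullback r Z.hom X.hom (Spec.map σ))
    {U : X.left.Opens} {V : Z.left.Opens} (hU : IsAffineOpen U) (hV : IsAffineOpen V)
    (h : V ≤ r ⁻¹ᵁ U) : LiftsUniquely σ.hom (Sections.map r h) := by
  intro Q _ N hN f g t hfg htf htg
  let f' : Γ(X.left, U) ⟶ .of Q := CommRingCat.ofHom f
  let g' : K' ⟶ .of Q := CommRingCat.ofHom g
  let t' : Γ(Z.left, V) ⟶ .of (Q ⧸ N) := CommRingCat.ofHom t
  let q : CommRingCat.of Q ⟶ .of (Q ⧸ N) := CommRingCat.ofHom (Ideal.Quotient.mk N)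
  have hfg' : structHom X U ≫ f' = σ ≫ g' := CommRingCat.hom_ext hfg
  have htf' : r.appLE U V h ≫ t' = f' ≫ q := CommRingCat.hom_ext htf
  have htg' : structHom Z V ≫ t' = g' ≫ q := CommRingCat.hom_ext htg
  suffices H : ∃! l : Γ(Z.left, V) ⟶ .of Q, r.appLE U V h ≫ l = f' ∧ structHom Z V ≫ l = g' ∧
      l ≫ q = t' by
    obtain ⟨l, ⟨h₁, h₂, h₃⟩, hl⟩ := H
    refine ⟨l.hom, ⟨congrArg CommRingCat.Hom.hom h₁, congrArg CommRingCat.Hom.hom h₂,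
      congrArg CommRingCat.Hom.hom h₃⟩, ?_⟩
    rintro l' ⟨h₁, h₂, h₃⟩
    exact congrArg CommRingCat.Hom.hom (hl (CommRingCat.ofHom l')
      ⟨CommRingCat.hom_ext h₁, CommRingCat.hom_ext h₂, CommRingCat.hom_ext h₃⟩)
  have hmk : Function.Surjective (Spec.map q) := by
    obtain ⟨n, hn⟩ := hN
    refine (PrimeSpectrum.comap_quotientMk_bijective_of_le_nilradical fun x hx => ⟨n, ?_⟩).2
    have := Ideal.pow_mem_pow hx n
    rwa [hn] at this
  have hc : (Spec.map f' ≫ hU.fromSpec) ≫ X.hom = Spec.map g' ≫ Spec.map σ := by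
    rw [Category.assoc, fromSpec_comp_hom, ← Spec.map_comp, ← Spec.map_comp, hfg']
  let W : Spec (.of Q) ⟶ Z.left := hr.lift (Spec.map f' ≫ hU.fromSpec) (Spec.map g') hc
  have hW : Spec.map q ≫ W = Spec.map t' ≫ hV.fromSpec := by
    apply hr.hom_ext
    · rw [Category.assoc, hr.lift_fst, Category.assoc,
        ← IsAffineOpen.SpecMap_appLE_fromSpec r hU hV h, ← Category.assoc, ← Category.assoc,
        ← Spec.map_comp, ← Spec.map_comp, htf']
    · rw [Category.assoc, hr.lift_snd, Category.assoc, fromSpec_comp_hom, ← Spec.map_comp,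
        ← Spec.map_comp, htg']
  have hWV : Set.range W ⊆ Set.range hV.fromSpec := by
    rintro _ ⟨x, rfl⟩
    obtain ⟨x, rfl⟩ := hmk x
    rw [← Scheme.Hom.comp_apply, hW]
    exact ⟨_, rfl⟩
  let L := IsOpenImmersion.lift hV.fromSpec W hWV
  have hL : L ≫ hV.fromSpec = W := IsOpenImmersion.lift_fac ..
  obtain ⟨l, hl⟩ := Spec.map_surjective L
  refine ⟨l, ⟨?_, ?_, ?_⟩, ?_⟩
  · apply Spec.map_injective
    rw [Spec.map_comp, hl, ← cancel_mono hU.fromSpec, Category.assoc,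
      IsAffineOpen.SpecMap_appLE_fromSpec r hU hV h, ← Category.assoc, hL, hr.lift_fst]
  · apply Spec.map_injective
    rw [Spec.map_comp, hl, ← fromSpec_comp_hom hV, ← Category.assoc, hL, hr.lift_snd]
  · apply Spec.map_injective
    rw [Spec.map_comp, hl, ← cancel_mono hV.fromSpec, Category.assoc, hL, hW]
  · rintro l' ⟨h₁, h₂, -⟩
    apply Spec.map_injective
    rw [hl, ← cancel_mono hV.fromSpec, hL]
    apply hr.hom_ext
    · rw [Category.assoc, hr.lift_fst, ← IsAffineOpen.SpecMap_appLE_fromSpec r hU hV h,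
        ← Category.assoc, ← Spec.map_comp, h₁]
    · rw [Category.assoc, hr.lift_snd, fromSpec_comp_hom, ← Spec.map_comp, h₂]

end Sheaf

section CoJets

variable {K K' : CommRingCat.{u}}

section Restrict

variable {T : Scheme.{u}}

/-- Restriction of sections of the structure sheaf. -/
noncomputable def res {W W' : T.Opens} (h : W' ≤ W) : Γ(T, W) →+* Γ(T, W') :=
  (T.presheaf.map (homOfLE h).op).hom

theorem res_res {W W' W'' : T.Opens} (h : W' ≤ W) (h' : W'' ≤ W') (s : Γ(T, W)) :
    res h' (res h s) = res (h'.trans h) s := by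
  simp only [res, ← RingHom.comp_apply, ← CommRingCat.hom_comp, ← Functor.map_comp]
  rfl

theorem res_self {W : T.Opens} (h : W ≤ W) (s : Γ(T, W)) : res h s = s := by
  simp [res]

theorem res_ext {ι : Type*} {W : T.Opens} (V : ι → T.Opens) (hV : ∀ i, V i ≤ W)
    (hW : ∀ x ∈ W, ∃ i, x ∈ V i) {s t : Γ(T, W)} (H : ∀ i, res (hV i) s = res (hV i) t) : s = t := by
  let V' : Set.range V → T.Opens := (↑)
  refine T.sheaf.eq_of_locally_eq' V' W
    (fun i => homOfLE (by obtain ⟨_, i, rfl⟩ := i; exact hV i)) ?_ s t ?_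
  · intro x hx
    obtain ⟨i, hi⟩ := hW x hx
    exact (TopologicalSpace.Opens.mem_iSup (s := V')).2 ⟨⟨V i, i, rfl⟩, hi⟩
  · rintro ⟨_, i, rfl⟩
    exact H i

theorem res_glue {ι : Type u} {W : T.Opens} (V : ι → T.Opens) (hV : ∀ i, V i ≤ W)
    (hW : ∀ x ∈ W, ∃ i, x ∈ V i) (s : ∀ i, Γ(T, V i))
    (H : ∀ i j, res (inf_le_left : V i ⊓ V j ≤ V i) (s i) = res inf_le_right (s j)) :
    ∃! t : Γ(T, W), ∀ i, res (hV i) t = s i :=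
  T.sheaf.existsUnique_gluing' V W (fun i => homOfLE (hV i))
    (fun x hx => TopologicalSpace.Opens.mem_iSup.2 (hW x hx)) s H

end Restrict

/-- The map on co-jets `coJ_X(U) → coJ_Z(V)` induced by `r : Z → X` over `σ : K → K'`. -/
noncomputable def coJetMap (m : ℕ) {X : Over (Spec K)} {Z : Over (Spec K')} (σ : K ⟶ K')
    (r : Z.left ⟶ X.left) (hr : r ≫ X.hom = Z.hom ≫ Spec.map σ)
    {U : X.left.Opens} {V : Z.left.Opens} (h : V ≤ r ⁻¹ᵁ U) :
    CoJet m K (Sections X U) →+ CoJet m K' (Sections Z V) :=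
  CoJet.map m σ.hom (Sections.map r h) (Sections.map_comp_algebraMap σ r hr h)

/-- The restriction map on co-jets. -/
noncomputable def coJetRes (m : ℕ) (X : Over (Spec K)) {U V : X.left.Opens} (h : V ≤ U) :
    CoJet m K (Sections X U) →+ CoJet m K (Sections X V) :=
  coJetMap m (𝟙 K) (𝟙 X.left) (by simp) h

theorem coJetMap_comp (m : ℕ) {K'' : CommRingCat.{u}} {X : Over (Spec K)} {Z : Over (Spec K')}
    {Z' : Over (Spec K'')} {σ : K ⟶ K'} {σ' : K' ⟶ K''} {σ'' : K ⟶ K''} (hσ : σ ≫ σ' = σ'')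
    {r : Z.left ⟶ X.left} {r' : Z'.left ⟶ Z.left} {r'' : Z'.left ⟶ X.left} (hr : r' ≫ r = r'')
    (h₁ : r ≫ X.hom = Z.hom ≫ Spec.map σ) (h₂ : r' ≫ Z.hom = Z'.hom ≫ Spec.map σ')
    (h₃ : r'' ≫ X.hom = Z'.hom ≫ Spec.map σ'') {U : X.left.Opens} {V : Z.left.Opens}
    {V' : Z'.left.Opens} (hV : V ≤ r ⁻¹ᵁ U) (hV' : V' ≤ r' ⁻¹ᵁ V) (hV'' : V' ≤ r'' ⁻¹ᵁ U)
    (x : CoJet m K (Sections X U)) :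
    coJetMap m σ' r' h₂ hV' (coJetMap m σ r h₁ hV x) = coJetMap m σ'' r'' h₃ hV'' x := by
  subst hσ hr
  ext
  change (PrincipalParts.map m _ _ _).comp (PrincipalParts.map m _ _ _) x.1 =
    PrincipalParts.map m _ _ _ x.1
  congr 1
  have e : (Sections.map r' hV').comp (Sections.map r hV) = Sections.map (r' ≫ r) hV'' :=
    congrArg CommRingCat.Hom.hom (Scheme.Hom.appLE_comp_appLE r' r U V V' hV hV')
  apply PrincipalParts.hom_ext
  · simp only [RingHom.comp_assoc, PrincipalParts.map_comp_algebraMap]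
    simp only [← RingHom.comp_assoc, PrincipalParts.map_comp_algebraMap]
    simp only [RingHom.comp_assoc, e]
  · simp only [RingHom.comp_assoc, PrincipalParts.map_comp_right]
    simp only [← RingHom.comp_assoc, PrincipalParts.map_comp_right]
    simp only [RingHom.comp_assoc, e]

theorem coJetMap_coJetRes (m : ℕ) {X : Over (Spec K)} {Z : Over (Spec K')} (σ : K ⟶ K')
    (r : Z.left ⟶ X.left) (hr : r ≫ X.hom = Z.hom ≫ Spec.map σ)
    {U U' : X.left.Opens} {V : Z.left.Opens} (h : V ≤ r ⁻¹ᵁ U') (h' : U' ≤ U)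
    (x : CoJet m K (Sections X U)) :
    coJetMap m σ r hr h (coJetRes m X h' x) =
      coJetMap m σ r hr (h.trans (r.preimage_mono h')) x :=
  coJetMap_comp m (Category.id_comp _) (Category.comp_id _) _ hr hr h' h
    (h.trans (r.preimage_mono h')) x

theorem coJetRes_coJetMap (m : ℕ) {X : Over (Spec K)} {Z : Over (Spec K')} (σ : K ⟶ K')
    (r : Z.left ⟶ X.left) (hr : r ≫ X.hom = Z.hom ≫ Spec.map σ)
    {U : X.left.Opens} {V V' : Z.left.Opens} (h : V ≤ r ⁻¹ᵁ U) (h' : V' ≤ V)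
    (x : CoJet m K (Sections X U)) :
    coJetRes m Z h' (coJetMap m σ r hr h x) = coJetMap m σ r hr (h'.trans h) x :=
  coJetMap_comp m (Category.comp_id _) (Category.id_comp _) hr _ hr h h' (h'.trans h) x

theorem coJetMap_smul (m : ℕ) {X : Over (Spec K)} {Z : Over (Spec K')} (σ : K ⟶ K')
    (r : Z.left ⟶ X.left) (hr : r ≫ X.hom = Z.hom ≫ Spec.map σ)
    {U : X.left.Opens} {V : Z.left.Opens} (h : V ≤ r ⁻¹ᵁ U) (a : Sections X U)
    (x : CoJet m K (Sections X U)) :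
    coJetMap m σ r hr h (a • x) = Sections.map r h a • coJetMap m σ r hr h x := by
  ext
  change PrincipalParts.map m _ _ _ (a • x.1) = _ • PrincipalParts.map m _ _ _ x.1
  rw [Algebra.smul_def, map_mul, Algebra.smul_def]
  congr 1
  exact RingHom.congr_fun (PrincipalParts.map_comp_algebraMap m _ _ _) a

theorem coJetRes_coJetRes (m : ℕ) (X : Over (Spec K)) {U V W : X.left.Opens} (h : V ≤ U)
    (h' : W ≤ V) (x : CoJet m K (Sections X U)) :
    coJetRes m X h' (coJetRes m X h x) = coJetRes m X (h'.trans h) x :=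
  coJetRes_coJetMap ..

/-- Restriction of sections. -/
noncomputable def Sections.res {X : Over (Spec K)} {U V : X.left.Opens} (h : V ≤ U) :
    Sections X U →+* Sections X V := Jets.res h

theorem coJetRes_smul (m : ℕ) (X : Over (Spec K)) {U V : X.left.Opens} (h : V ≤ U)
    (a : Sections X U) (x : CoJet m K (Sections X U)) :
    coJetRes m X h (a • x) = Sections.res h a • coJetRes m X h x := by
  refine (coJetMap_smul ..).trans (congrArg (· • _) ?_)
  change ((𝟙 X.left : X.left ⟶ X.left).appLE U V h).hom a = Jets.res h a
  simp only [Scheme.Hom.appLE, Scheme.Hom.id_app]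
  rfl

/-- The group `Hom(g^* coJ_X, 𝒪_Y)` of `𝒪_Y`-linear maps, for a morphism `g : Y → X`, where
`coJ_X` is the sheaf of `m`-th co-jets of `X` over `K`. Since `coJ_X` is the sheaf associated to
`U ↦ CoJet m K 𝒪_X(U)`, such a map is the same as an `𝒪_X`-linear morphism of presheaves from the
latter to `g_* 𝒪_Y`. -/
@[ext]
structure CoJetHom (m : ℕ) (X : Over (Spec K)) {Y : Scheme.{u}} (g : Y ⟶ X.left) where
  /-- The component over `U`. -/
  toFun (U : X.left.Opens) : CoJet m K (Sections X U) →+ Γ(Y, g ⁻¹ᵁ U)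
  map_smul (U : X.left.Opens) (a : Sections X U) (x : CoJet m K (Sections X U)) :
    toFun U (a • x) = (g.app U).hom a * toFun U x
  map_res {U V : X.left.Opens} (h : V ≤ U) (x : CoJet m K (Sections X U)) :
    toFun V (coJetRes m X h x) = res (g.preimage_mono h) (toFun U x)

theorem preimage_le {X Y Z : Scheme.{u}} {p : Y ⟶ Z} {r : Z ⟶ X} {g : Y ⟶ X} (hg : p ≫ r = g)
    (U : X.Opens) : g ⁻¹ᵁ U ≤ p ⁻¹ᵁ (r ⁻¹ᵁ U) := by
  subst hg; rfl

theorem appLE_app {X Y Z : Scheme.{u}} {p : Y ⟶ Z} {r : Z ⟶ X} {g : Y ⟶ X} (hg : p ≫ r = g)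
    {U : X.Opens} {W : Y.Opens} (h : W ≤ p ⁻¹ᵁ (r ⁻¹ᵁ U)) (h' : W ≤ g ⁻¹ᵁ U) (a : Γ(X, U)) :
    (p.appLE (r ⁻¹ᵁ U) W h).hom ((r.app U).hom a) = (g.appLE U W h').hom a := by
  subst hg
  rw [← RingHom.comp_apply, ← CommRingCat.hom_comp, Scheme.Hom.app_eq_appLE,
    Scheme.Hom.appLE_comp_appLE]

theorem appLE_appLE {X Y Z : Scheme.{u}} {p : Y ⟶ Z} {r : Z ⟶ X} {g : Y ⟶ X} (hg : p ≫ r = g)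
    {U : X.Opens} {V : Z.Opens} {W : Y.Opens} (h₁ : V ≤ r ⁻¹ᵁ U) (h₂ : W ≤ p ⁻¹ᵁ V)
    (h₃ : W ≤ g ⁻¹ᵁ U) (a : Γ(X, U)) :
    (p.appLE V W h₂).hom ((r.appLE U V h₁).hom a) = (g.appLE U W h₃).hom a := by
  subst hg
  rw [← RingHom.comp_apply, ← CommRingCat.hom_comp, Scheme.Hom.appLE_comp_appLE]

theorem res_appLE {X Y : Scheme.{u}} (p : Y ⟶ X) {V : X.Opens} {W W' : Y.Opens} (h : W ≤ p ⁻¹ᵁ V)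
    (h' : W' ≤ W) (a : Γ(X, V)) :
    res h' ((p.appLE V W h).hom a) = (p.appLE V W' (h'.trans h)).hom a := by
  simp only [res, ← RingHom.comp_apply, ← CommRingCat.hom_comp, Scheme.Hom.appLE_map]

theorem res_app {X Y : Scheme.{u}} (p : Y ⟶ X) {V : X.Opens} {W : Y.Opens} (h : W ≤ p ⁻¹ᵁ V)
    (a : Γ(X, V)) : res h ((p.app V).hom a) = (p.appLE V W h).hom a := rfl

theorem app_apply {X Y : Scheme.{u}} (p : Y ⟶ X) (V : X.Opens) (a : Γ(X, V)) :
    (p.app V).hom a = (p.appLE V (p ⁻¹ᵁ V) le_rfl).hom a := by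
  rw [Scheme.Hom.app_eq_appLE]

theorem appLE_res {X Y : Scheme.{u}} (f : Y ⟶ X) {V V' : X.Opens} {W W' : Y.Opens} (h : V' ≤ V)
    (h₁ : W' ≤ f ⁻¹ᵁ V') (h₂ : W ≤ f ⁻¹ᵁ V) (h₃ : W' ≤ W) (a : Γ(X, V)) :
    (f.appLE V' W' h₁).hom (res h a) = res h₃ ((f.appLE V W h₂).hom a) := by
  simp only [res, ← RingHom.comp_apply, ← CommRingCat.hom_comp, Scheme.Hom.map_appLE,
      Scheme.Hom.appLE_map]

namespace CoJetHom

variable {m : ℕ} {X : Over (Spec K)}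

/-- Pulling back along `f : Y' → Y`. -/
noncomputable def comp {Y Y' : Scheme.{u}} {g : Y ⟶ X.left} (ν : CoJetHom m X g) (f : Y' ⟶ Y)
    {g' : Y' ⟶ X.left} (hg : f ≫ g = g') : CoJetHom m X g' where
  toFun U := (f.appLE (g ⁻¹ᵁ U) (g' ⁻¹ᵁ U) (preimage_le hg U)).hom.toAddMonoidHom.comp (ν.toFun U)
  map_smul U a x := by
    change (f.appLE _ _ _).hom (ν.toFun U (a • x)) = _ * (f.appLE _ _ _).hom (ν.toFun U x)
    rw [ν.map_smul, map_mul]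
    exact congrArg (· * _) ((appLE_app hg _ le_rfl a).trans (app_apply g' U a).symm)
  map_res {U V} h x := by
    change (f.appLE _ _ _).hom (ν.toFun V _) = res _ ((f.appLE _ _ _).hom (ν.toFun U x))
    rw [ν.map_res]
    exact appLE_res ..

/-- Composing with the map of co-jets induced by `r : Z → X` over `σ : K → K'`. -/
noncomputable def push {Z : Over (Spec K')} {Y : Scheme.{u}} {p : Y ⟶ Z.left}
    (μ : CoJetHom m Z p) (σ : K ⟶ K') (r : Z.left ⟶ X.left)
    (hr : r ≫ X.hom = Z.hom ≫ Spec.map σ) {g : Y ⟶ X.left} (hg : p ≫ r = g) :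
    CoJetHom m X g where
  toFun U := (res (preimage_le hg U)).toAddMonoidHom.comp
    ((μ.toFun (r ⁻¹ᵁ U)).comp (coJetMap m σ r hr le_rfl))
  map_smul U a x := by
    change res _ (μ.toFun _ (coJetMap m σ r hr _ (a • x))) = _ * res _ (μ.toFun _ _)
    rw [coJetMap_smul, μ.map_smul, map_mul]
    exact congrArg (· * _) ((appLE_appLE hg le_rfl _ le_rfl a).trans (app_apply g U a).symm)
  map_res {U V} h x := by
    change res _ (μ.toFun _ (coJetMap m σ r hr _ (coJetRes m X h x))) =
      res _ (res _ (μ.toFun _ (coJetMap m σ r hr _ x)))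
    have e : coJetMap m σ r hr le_rfl (coJetRes m X h x) =
        coJetRes m Z (r.preimage_mono h) (coJetMap m σ r hr le_rfl x) :=
      (coJetMap_coJetRes ..).trans (coJetRes_coJetMap m σ r hr le_rfl (r.preimage_mono h) x).symm
    rw [e, μ.map_res, res_res, res_res]

theorem push_toFun {Z : Over (Spec K')} {Y : Scheme.{u}} {p : Y ⟶ Z.left}
    (μ : CoJetHom m Z p) (σ : K ⟶ K') (r : Z.left ⟶ X.left)
    (hr : r ≫ X.hom = Z.hom ≫ Spec.map σ) {g : Y ⟶ X.left} (hg : p ≫ r = g) (U : X.left.Opens)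
    (x : CoJet m K (Sections X U)) :
    (μ.push σ r hr hg).toFun U x =
      res (preimage_le hg U) (μ.toFun (r ⁻¹ᵁ U) (coJetMap m σ r hr le_rfl x)) := rfl

/-- A compatible family of semilinear maps on a basis of opens extends uniquely. -/
theorem existsUnique_glue {Y : Scheme.{u}} (g : Y ⟶ X.left) (B : X.left.Opens → Prop)
    (hB : ∀ (U : X.left.Opens) (x : X.left), x ∈ U → ∃ V, B V ∧ x ∈ V ∧ V ≤ U)
    (f : ∀ V, B V → (CoJet m K (Sections X V) →+ Γ(Y, g ⁻¹ᵁ V)))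
    (hf : ∀ V hV (a : Sections X V) x, f V hV (a • x) = (g.app V).hom a * f V hV x)
    (hres : ∀ V hV V' hV' (h : V' ≤ V) x,
      f V' hV' (coJetRes m X h x) = res (g.preimage_mono h) (f V hV x)) :
    ∃! ν : CoJetHom m X g, ∀ V hV, ν.toFun V = f V hV := by
  have H (U : X.left.Opens) (x : CoJet m K (Sections X U)) :
      ∃! t : Γ(Y, g ⁻¹ᵁ U), ∀ i : {V // B V ∧ V ≤ U},
        res (g.preimage_mono i.2.2) t = f i.1 i.2.1 (coJetRes m X i.2.2 x) := by
    refine res_glue (fun i : {V // B V ∧ V ≤ U} => g ⁻¹ᵁ i.1) (fun i => g.preimage_mono i.2.2)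
      ?_ _ ?_
    · intro y hy
      obtain ⟨V, hV, hy', hVU⟩ := hB U (g y) hy
      exact ⟨⟨V, hV, hVU⟩, hy'⟩
    · rintro ⟨V₁, hV₁, h₁⟩ ⟨V₂, hV₂, h₂⟩
      refine res_ext (fun i : {V // B V ∧ V ≤ V₁ ⊓ V₂} => g ⁻¹ᵁ i.1)
        (fun i => g.preimage_mono i.2.2) ?_ ?_
      · intro y hy
        obtain ⟨V, hV, hy', hVU⟩ := hB (V₁ ⊓ V₂) (g y) hy
        exact ⟨⟨V, hV, hVU⟩, hy'⟩
      · rintro ⟨V, hV, h⟩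
        have e₁ := hres V₁ hV₁ V hV (h.trans inf_le_left) (coJetRes m X h₁ x)
        have e₂ := hres V₂ hV₂ V hV (h.trans inf_le_right) (coJetRes m X h₂ x)
        rw [coJetRes_coJetRes] at e₁ e₂
        exact (res_res _ _ _).trans (e₁.symm.trans (e₂.trans (res_res _ _ _).symm))
  choose F hF hF' using H
  have ext' (U : X.left.Opens) (s t : Γ(Y, g ⁻¹ᵁ U)) (h : ∀ V, B V → ∀ hVU : V ≤ U,
      res (g.preimage_mono hVU) s = res (g.preimage_mono hVU) t) : s = t := by
    refine res_ext (fun i : {V // B V ∧ V ≤ U} => g ⁻¹ᵁ i.1) (fun i => g.preimage_mono i.2.2) ?_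
      fun i => h _ i.2.1 i.2.2
    intro y hy
    obtain ⟨V, hV, hy', hVU⟩ := hB U (g y) hy
    exact ⟨⟨V, hV, hVU⟩, hy'⟩
  have hF'' (U V : X.left.Opens) (hV : B V) (h : V ≤ U) (x) :
      res (g.preimage_mono h) (F U x) = f V hV (coJetRes m X h x) := hF U x ⟨V, hV, h⟩
  refine ⟨⟨fun U => AddMonoidHom.mk' (F U) ?_, ?_, ?_⟩, ?_, ?_⟩
  · intro x y
    refine ext' _ _ _ fun V hV h => ?_
    rw [map_add, hF'' U V hV h, hF'' U V hV h, hF'' U V hV h, map_add, map_add]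
  · intro U a x
    refine ext' _ _ _ fun V hV h => ?_
    change res _ (F U (a • x)) = res _ (_ * F U x)
    rw [map_mul, hF'' U V hV h, hF'' U V hV h, coJetRes_smul, hf]
    exact congrArg (· * _) ((app_apply g V _).trans
      ((appLE_res g h _ le_rfl _ a).trans (congrArg _ (app_apply g U a).symm)))
  · intro U U' h x
    refine ext' _ _ _ fun V hV h' => ?_
    change res _ (F U' _) = res _ (res _ (F U x))
    rw [res_res, hF'' U' V hV h', hF'' U V hV (h'.trans h), coJetRes_coJetRes]
  · intro V hV
    ext x
    change F V x = _
    rw [← res_self (g.preimage_mono le_rfl) (F V x), hF'' V V hV le_rfl, hres V hV V hV, res_self]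
  · intro ν hν
    ext U x
    change _ = F U x
    refine ext' _ _ _ fun V hV h => ?_
    rw [hF'' U V hV h, ← ν.map_res h, hν V hV]

/-- The component of the base change over affine opens. -/
theorem existsUnique_baseChange_aux {Z : Over (Spec K')} {σ : K ⟶ K'} {r : Z.left ⟶ X.left}
    (hr : IsPullback r Z.hom X.hom (Spec.map σ)) {Y : Scheme.{u}} (p : Y ⟶ Z.left) {g : Y ⟶ X.left}
    (hg : p ≫ r = g) (ν : CoJetHom m X g) {U : X.left.Opens} {V : Z.left.Opens}
    (hU : IsAffineOpen U) (hV : IsAffineOpen V) (h : V ≤ r ⁻¹ᵁ U) {W : Y.Opens}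
    (hW : W ≤ p ⁻¹ᵁ V) (hW' : W ≤ g ⁻¹ᵁ U) :
    ∃! f : CoJet m K' (Sections Z V) →+ Γ(Y, W),
      (∀ (a : Sections Z V) x, f (a • x) = (p.appLE V W hW).hom a * f x) ∧
      ∀ x, f (coJetMap m σ r hr.w h x) = Jets.res hW' (ν.toFun U x) := by
  refine CoJet.existsUnique_extend m σ.hom (Sections.map r h)
    (Sections.map_comp_algebraMap σ r hr.w h) (isPullback_liftsUniquely hr hU hV h)
    (p.appLE V W hW).hom ((Jets.res hW').toAddMonoidHom.comp (ν.toFun U)) fun a x => ?_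
  change Jets.res hW' (ν.toFun U (a • x)) = _ * Jets.res hW' (ν.toFun U x)
  rw [ν.map_smul, map_mul]
  exact congrArg (· * _) (appLE_appLE hg h hW hW' a).symm

/-- Base change of co-jet homomorphisms along `σ : K → K'`: if `Z = X ×_K K'`, an `𝒪_Y`-linear map
`g^* coJ_X → 𝒪_Y` extends uniquely along the canonical map from `coJ_X` to `coJ_Z`. -/
theorem existsUnique_baseChange {Z : Over (Spec K')} {σ : K ⟶ K'} {r : Z.left ⟶ X.left}
    (hr : IsPullback r Z.hom X.hom (Spec.map σ)) {Y : Scheme.{u}} (p : Y ⟶ Z.left) {g : Y ⟶ X.left}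
    (hg : p ≫ r = g) (ν : CoJetHom m X g) :
    ∃! μ : CoJetHom m Z p, μ.push σ r hr.w hg = ν := by
  let B (V : Z.left.Opens) : Prop :=
    IsAffineOpen V ∧ ∃ U : X.left.Opens, IsAffineOpen U ∧ V ≤ r ⁻¹ᵁ U
  have hpg {U : X.left.Opens} {V : Z.left.Opens} (h : V ≤ r ⁻¹ᵁ U) : p ⁻¹ᵁ V ≤ g ⁻¹ᵁ U := by
    subst hg; exact p.preimage_mono h
  -- opens in `B` lying over a given open of `X`
  have hB (V : Z.left.Opens) (U : X.left.Opens) (hVU : V ≤ r ⁻¹ᵁ U) (z : Z.left) (hz : z ∈ V) :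
      ∃ (V' : Z.left.Opens) (U' : X.left.Opens), IsAffineOpen V' ∧ IsAffineOpen U' ∧
        V' ≤ r ⁻¹ᵁ U' ∧ z ∈ V' ∧ V' ≤ V ∧ U' ≤ U := by
    obtain ⟨U', hU', hzU', hUU'⟩ := exists_isAffineOpen_mem_and_subset (x := r z) (U := U)
      (hVU hz)
    obtain ⟨V', hV', hzV', hVV'⟩ := exists_isAffineOpen_mem_and_subset (x := z)
      (U := V ⊓ r ⁻¹ᵁ U') ⟨hz, hzU'⟩
    exact ⟨V', U', hV', hU', fun y hy => (hVV' hy).2, hzV', fun y hy => (hVV' hy).1, hUU'⟩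
  choose! F hF using fun (V : Z.left.Opens) (U : X.left.Opens) (hV : IsAffineOpen V)
    (hU : IsAffineOpen U) (h : V ≤ r ⁻¹ᵁ U) =>
      existsUnique_baseChange_aux hr p hg ν hU hV h (le_refl (p ⁻¹ᵁ V)) (hpg h)
  -- restricting to a smaller open
  have h₁ {V V' : Z.left.Opens} {U U' : X.left.Opens} (hV : IsAffineOpen V) (hV' : IsAffineOpen V')
      (hU : IsAffineOpen U) (hU' : IsAffineOpen U') (h : V ≤ r ⁻¹ᵁ U) (h' : V' ≤ r ⁻¹ᵁ U')
      (hVV' : V' ≤ V) (hUU' : U' ≤ U) (x) :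
      F V' U' (coJetRes m Z hVV' x) = Jets.res (p.preimage_mono hVV') (F V U x) := by
    have key := (existsUnique_baseChange_aux hr p hg ν hU hV h (p.preimage_mono hVV')
      (hpg (hVV'.trans h))).unique
      (y₁ := (F V' U').comp (coJetRes m Z hVV'))
      (y₂ := (Jets.res (p.preimage_mono hVV')).toAddMonoidHom.comp (F V U)) ⟨?_, ?_⟩ ⟨?_, ?_⟩
    · exact DFunLike.congr_fun key x
    · intro a x
      change F V' U' (coJetRes m Z hVV' (a • x)) = _ * F V' U' (coJetRes m Z hVV' x)
      rw [coJetRes_smul, (hF V' U' hV' hU' h').1.1]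
      exact congrArg (· * _) ((appLE_res p hVV' le_rfl le_rfl (p.preimage_mono hVV') a).trans
        (res_appLE _ _ _ _))
    · intro x
      change F V' U' (coJetRes m Z hVV' (coJetMap m σ r hr.w h x)) = _
      rw [coJetRes_coJetMap, ← coJetMap_coJetRes m σ r hr.w h' hUU',
        (hF V' U' hV' hU' h').1.2, ν.map_res hUU', res_res]
    · intro a x
      change Jets.res _ (F V U (a • x)) = _ * Jets.res _ (F V U x)
      rw [(hF V U hV hU h).1.1, map_mul]
      exact congrArg (· * _) (res_appLE ..)
    · intro x
      change Jets.res _ (F V U _) = _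
      rw [(hF V U hV hU h).1.2, res_res]
  have h₂ {V V' : Z.left.Opens} {U U' : X.left.Opens} (hV : IsAffineOpen V) (hV' : IsAffineOpen V')
      (hU : IsAffineOpen U) (hU' : IsAffineOpen U') (h : V ≤ r ⁻¹ᵁ U) (h' : V' ≤ r ⁻¹ᵁ U')
      (hVV' : V' ≤ V) (x) :
      F V' U' (coJetRes m Z hVV' x) = Jets.res (p.preimage_mono hVV') (F V U x) := by
    let I := {i : Z.left.Opens × X.left.Opens // IsAffineOpen i.1 ∧ IsAffineOpen i.2 ∧
      i.1 ≤ r ⁻¹ᵁ i.2 ∧ i.1 ≤ V' ∧ i.2 ≤ U ⊓ U'}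
    refine res_ext (fun i : I => p ⁻¹ᵁ i.1.1) (fun i => p.preimage_mono i.2.2.2.2.1) ?_ ?_
    · intro y hy
      obtain ⟨V₃, U₃, a, b, c, d, e, f⟩ := hB V' (U ⊓ U')
        (fun z hz => ⟨h (hVV' hz), h' hz⟩) (p y) hy
      exact ⟨⟨(V₃, U₃), a, b, c, e, f⟩, d⟩
    · rintro ⟨⟨V₃, U₃⟩, a, b, c, d, e⟩
      change V₃ ≤ V' at d
      change U₃ ≤ U ⊓ U' at e
      have e₁ := h₁ hV' a hU' b h' c d (e.trans inf_le_right) (coJetRes m Z hVV' x)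
      have e₂ := h₁ hV a hU b h c (d.trans hVV') (e.trans inf_le_left) x
      rw [coJetRes_coJetRes] at e₁
      exact e₁.symm.trans (e₂.trans (res_res _ _ _).symm)
  choose! U hU using fun (V : Z.left.Opens) (hV : B V) => hV.2
  obtain ⟨μ, hμ, hμ'⟩ := existsUnique_glue (X := Z) p B
    (fun V z hz => by
      obtain ⟨V₃, U₃, a, b, c, d, e, -⟩ := hB V ⊤ le_top z hz
      exact ⟨V₃, ⟨a, U₃, b, c⟩, d, e⟩)
    (fun V _ => F V (U V))
    (fun V hV a x => by
      rw [(hF V _ hV.1 (hU V hV).1 (hU V hV).2).1.1]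
      exact congrArg (· * _) (app_apply p V a).symm)
    (fun V hV V' hV' h x => h₂ hV.1 hV'.1 (hU V hV).1 (hU V' hV').1 (hU V hV).2 (hU V' hV').2 h x)
  refine ⟨μ, ?_, ?_⟩
  · ext U₀ x
    let I := {i : Z.left.Opens × X.left.Opens // IsAffineOpen i.1 ∧ IsAffineOpen i.2 ∧
      i.1 ≤ r ⁻¹ᵁ i.2 ∧ i.2 ≤ U₀}
    refine res_ext (fun i : I => p ⁻¹ᵁ i.1.1) (fun i => hpg (i.2.2.2.1.trans
      (r.preimage_mono i.2.2.2.2))) ?_ ?_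
    · intro y hy
      have hy' : p y ∈ r ⁻¹ᵁ U₀ := by subst hg; exact hy
      obtain ⟨V₃, U₃, a, b, c, d, -, f⟩ := hB _ U₀ le_rfl (p y) hy'
      exact ⟨⟨(V₃, U₃), a, b, c, f⟩, d⟩
    · rintro ⟨⟨V₃, U₃⟩, a, b, c, d⟩
      change V₃ ≤ r ⁻¹ᵁ U₃ at c
      change U₃ ≤ U₀ at d
      have hV₃ : B V₃ := ⟨a, U₃, b, c⟩
      have e₁ := μ.map_res (c.trans (r.preimage_mono d)) (coJetMap m σ r hr.w le_rfl x)
      rw [hμ V₃ hV₃, coJetRes_coJetMap] at e₁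
      have e₂ := h₂ a a (hU V₃ hV₃).1 b (hU V₃ hV₃).2 c le_rfl
        (coJetMap m σ r hr.w (c.trans (r.preimage_mono d)) x)
      rw [coJetRes_coJetMap, res_self, ← coJetMap_coJetRes m σ r hr.w c d,
        (hF V₃ U₃ a b c).1.2, ν.map_res d, res_res] at e₂
      rw [coJetMap_coJetRes] at e₂
      exact (res_res _ _ _).trans (e₁.symm.trans e₂.symm)
  · intro μ' h'
    refine hμ' μ' fun V hV => ?_
    refine (hF V _ hV.1 (hU V hV).1 (hU V hV).2).2 _ ⟨?_, ?_⟩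
    · intro a x
      rw [μ'.map_smul]
      exact congrArg (· * _) (app_apply p V a)
    · intro x
      rw [← h', push_toFun, res_res, ← coJetRes_coJetMap m σ r hr.w le_rfl (hU V hV).2]
      exact μ'.map_res _ _

end CoJetHom

end CoJets

namespace CoJetHom

variable {K : CommRingCat.{u}} {m : ℕ} {X : Over (Spec K)}

theorem comp_id {Y : Scheme.{u}} {g : Y ⟶ X.left} (ν : CoJetHom m X g) :
    ν.comp (𝟙 Y) (Category.id_comp g) = ν := by
  ext U x
  change ((𝟙 Y : Y ⟶ Y).appLE _ _ _).hom (ν.toFun U x) = _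
  simp only [Scheme.Hom.appLE, Scheme.Hom.id_app]
  exact res_self le_rfl _

theorem comp_comp {Y Y' Y'' : Scheme.{u}} {g : Y ⟶ X.left} (ν : CoJetHom m X g) (f : Y' ⟶ Y)
    {g' : Y' ⟶ X.left} (hg : f ≫ g = g') (f' : Y'' ⟶ Y') {g'' : Y'' ⟶ X.left}
    (hg' : f' ≫ g' = g'') {f'' : Y'' ⟶ Y} (hf : f' ≫ f = f'') (hg'' : f'' ≫ g = g'') :
    (ν.comp f hg).comp f' hg' = ν.comp f'' hg'' := by
  ext U x
  exact appLE_appLE hf _ _ _ _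

end CoJetHom

/-- The functor `(g : Y → X) ↦ Hom(g^* coJ_X, 𝒪_Y)` on schemes over `X`, where `coJ_X` is the
sheaf of `m`-th co-jets of `X` over `K`. -/
noncomputable def jetFunctor {K : CommRingCat.{u}} (m : ℕ) (X : Over (Spec K)) :
    (Over X.left)ᵒᵖ ⥤ Type u where
  obj Y := CoJetHom m X Y.unop.hom
  map f := ↾fun ν => ν.comp f.unop.left (Over.w f.unop)
  map_id Y := by
    refine ConcreteCategory.hom_ext _ _ fun ν => ?_
    exact CoJetHom.comp_id ν
  map_comp f f' := by
    refine ConcreteCategory.hom_ext _ _ fun ν => ?_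
    exact (CoJetHom.comp_comp ν _ (Over.w f.unop) _ (Over.w f'.unop) rfl
      (Over.w (f'.unop ≫ f.unop))).symm

/-- A `m`-th jet space of `X` over `K`: a scheme over `X` representing `jetFunctor m X`, i.e. the
relative spectrum of the symmetric algebra of `coJ_X`. -/
structure JetSpace {K : CommRingCat.{u}} (m : ℕ) (X : Over (Spec K)) where
  /-- The underlying scheme over `X`. -/
  obj : Over X.left
  /-- The universal property. -/
  rep : (jetFunctor m X).RepresentableBy obj

namespace JetSpace

variable {K : CommRingCat.{u}} {m : ℕ} {X Y : Over (Spec K)}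

/-- The jet space as a scheme over `K`. -/
noncomputable def toOver (J : JetSpace m X) : Over (Spec K) := Over.mk (J.obj.hom ≫ X.hom)

/-- The structure morphism `Jet^m X → X`. -/
noncomputable def proj (J : JetSpace m X) : J.toOver ⟶ X := Over.homMk J.obj.hom rfl

/-- The universal co-jet homomorphism. -/
noncomputable def univ (J : JetSpace m X) : CoJetHom m X J.proj.left := J.rep.homEquiv (𝟙 J.obj)

/-- The point of `Jet^m X` given by a pair `(p, ν)`. -/
noncomputable def desc (J : JetSpace m X) {T : Over (Spec K)} (p : T ⟶ X)
    (ν : CoJetHom m X p.left) : T ⟶ J.toOver :=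
  let F : Over.mk p.left ⟶ J.obj := J.rep.homEquiv.symm ν
  Over.homMk F.left (by
    have := Over.w F
    dsimp at this
    simp [toOver, reassoc_of% this])

/-- `Jet^m g : Jet^m X → Jet^m Y`. -/
noncomputable def map (J : JetSpace m X) (J' : JetSpace m Y) (g : X ⟶ Y) : J.toOver ⟶ J'.toOver :=
  J'.desc (J.proj ≫ g) (J.univ.push (𝟙 K) g.left (by simp) rfl)

end JetSpace

/-- A Weil restriction along `f : T → S` of a scheme `Y` over `T`: a scheme over `S` representing
`U ↦ Hom_T(U ×_S T, Y)`. -/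
structure WeilRestriction {S T : Scheme.{u}} (f : T ⟶ S) (Y : Over T) where
  /-- The underlying scheme over `S`. -/
  obj : Over S
  /-- The universal property. -/
  rep : ((Over.pullback f).op ⋙ yoneda.obj Y).RepresentableBy obj

/-- For `s e : K → B`, a prolongation space of `X`: a Weil restriction along `s` of the base change
of `X` along `e`. -/
abbrev Prolongation {K B : CommRingCat.{u}} (s e : K ⟶ B) (X : Over (Spec K)) : Type (u + 1) :=
  WeilRestriction (Spec.map s) ((Over.pullback (Spec.map e)).obj X)

/-- `T ↦ T ×_K B`, the base change along `s`, regarded as a scheme over `K` through `e`. -/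
noncomputable abbrev twist {K B : CommRingCat.{u}} (s e : K ⟶ B) :
    Over (Spec K) ⥤ Over (Spec K) :=
  Over.pullback (Spec.map s) ⋙ Over.map (Spec.map e)

/-- For `α : B → B'` carrying `s, e` to `s', e'`, the morphism `T ×_K B' → T ×_K B`. -/
noncomputable def twistMap {K B B' : CommRingCat.{u}} {s e : K ⟶ B} {s' e' : K ⟶ B'}
    (α : B ⟶ B') (hs : s ≫ α = s') (he : e ≫ α = e') (T : Over (Spec K)) :
    (twist s' e').obj T ⟶ (twist s e).obj T :=
  Over.homMk
    (pullback.lift (pullback.fst T.hom (Spec.map s')) (pullback.snd _ _ ≫ Spec.map α)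
      (by rw [pullback.condition, Category.assoc, ← Spec.map_comp, hs]))
    ((pullback.lift_snd_assoc _ _ _ _).trans
      (show (pullback.snd T.hom (Spec.map s') ≫ Spec.map α) ≫ Spec.map e =
          pullback.snd T.hom (Spec.map s') ≫ Spec.map e' by
        rw [Category.assoc, ← Spec.map_comp, he]))

namespace Prolongation

variable {K B B' B'' : CommRingCat.{u}} {s e : K ⟶ B} {s' e' : K ⟶ B'} {s'' e'' : K ⟶ B''}
  {X Y : Over (Spec K)}

/-- The points of a prolongation space of `X` with values in `T` are the morphisms over `K`, with
respect to `e`, from `T ×_K B` to `X`. -/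
noncomputable def pointEquiv (P : Prolongation s e X) (T : Over (Spec K)) :
    (T ⟶ P.obj) ≃ ((twist s e).obj T ⟶ X) :=
  P.rep.homEquiv.trans ((Over.mapPullbackAdj (Spec.map e)).homEquiv _ _).symm

/-- The canonical morphism `r : τ X ×_K B → X`. -/
noncomputable def canonical (P : Prolongation s e X) : (twist s e).obj P.obj ⟶ X :=
  P.pointEquiv P.obj (𝟙 P.obj)

theorem pointEquiv_apply (P : Prolongation s e X) {T : Over (Spec K)} (p : T ⟶ P.obj) :
    P.pointEquiv T p = (twist s e).map p ≫ P.canonical := by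
  have h : P.rep.homEquiv p = (Over.pullback (Spec.map s)).map p ≫ P.rep.homEquiv (𝟙 P.obj) := by
    have := P.rep.homEquiv_comp p (𝟙 P.obj)
    rwa [Category.comp_id] at this
  exact (congrArg ((Over.mapPullbackAdj (Spec.map e)).homEquiv _ _).symm h).trans
    (Adjunction.homEquiv_naturality_left_symm ..)

/-- `τ(g) : τ X → τ Y`, the Weil restriction of the base change of `g` along `e`. -/
noncomputable def map (P : Prolongation s e X) (Q : Prolongation s e Y) (g : X ⟶ Y) :
    P.obj ⟶ Q.obj :=
  Q.rep.homEquiv.symm (P.rep.homEquiv (𝟙 P.obj) ≫ (Over.pullback (Spec.map e)).map g)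

/-- The comparison morphism `α̂ : τ X → τ' X` induced by `α : B → B'`: on points it is
precomposition with `T ×_K B' → T ×_K B`. -/
noncomputable def comparison (P : Prolongation s e X) (P' : Prolongation s' e' X) (α : B ⟶ B')
    (hs : s ≫ α = s') (he : e ≫ α = e') : P.obj ⟶ P'.obj :=
  (P'.pointEquiv P.obj).symm (twistMap α hs he P.obj ≫ P.canonical)

/-- The morphism `τ' τ X → τ'' X` for the composite of two prolongation structures: the
corresponding morphism to `X` is
`τ' τ X ×_K B'' → τ X ×_K B → X`, where the first map is given by
`τ' τ X ×_K B'' → τ' τ X ×_K B' → τ X` and by `i : B → B''`. -/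
noncomputable def collapse (P : Prolongation s e X) (Q : Prolongation s' e' P.obj)
    (R : Prolongation s'' e'' X) (i : B ⟶ B'') (j : B' ⟶ B'') (h₁ : s' ≫ j = s'')
    (h₂ : e' ≫ j = s ≫ i) (h₃ : e ≫ i = e'') : Q.obj ⟶ R.obj :=
  let a : (twist s'' (e' ≫ j)).obj Q.obj ⟶ P.obj := twistMap j h₁ rfl Q.obj ≫ Q.canonical
  (R.pointEquiv Q.obj).symm
    ((Over.homMk (pullback.lift a.left (pullback.snd Q.obj.hom (Spec.map s'') ≫ Spec.map i)
        ((Over.w a).trans (by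
          rw [Category.assoc, ← Spec.map_comp, ← h₂]; rfl)))
      ((pullback.lift_snd_assoc _ _ _ _).trans
        (show (pullback.snd Q.obj.hom (Spec.map s'') ≫ Spec.map i) ≫ Spec.map e =
            pullback.snd Q.obj.hom (Spec.map s'') ≫ Spec.map e'' by
          rw [Category.assoc, ← Spec.map_comp, h₃])) : (twist s'' e'').obj Q.obj ⟶ (twist s e).obj P.obj) ≫ P.canonical)

end Prolongation

section Interpolation

variable {K B : CommRingCat.{u}} {s e : K ⟶ B} {X : Over (Spec K)} {m : ℕ}

/-- The base change `p^* coJ_Y ⊗_K B → 𝒪_T ⊗_K B` of a homomorphism `ν : p^* coJ_Y → 𝒪_T`, for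
`p : T → Y` over `K`. Here `(p^* coJ_Y) ⊗_K B` is the pullback of the co-jets of `Y ×_K B` over
`B`; the base change is characterized by its restriction to `coJ_Y`. -/
noncomputable def CoJetHom.baseChange {Y T : Over (Spec K)} {p : T ⟶ Y}
    (ν : CoJetHom m Y p.left) (s : K ⟶ B) :
    CoJetHom m ((Over.pullback (Spec.map s)).obj Y) ((Over.pullback (Spec.map s)).map p).left :=
  (CoJetHom.existsUnique_baseChange (IsPullback.of_hasPullback Y.hom (Spec.map s))
    ((Over.pullback (Spec.map s)).map p).left
    (pullback.lift_fst _ _ _)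
    (ν.comp (pullback.fst T.hom (Spec.map s)) rfl)).choose

/-- The value of the interpolating map at a point `(p, ν)` of `Jet^m (τ X)`, as a morphism
`T ×_K B → Jet^m X`: it is the pair consisting of the point `p̂ : T ×_K B → X` corresponding to `p`
and of the composite of `p̂^* coJ_X → (p^* coJ_{τ X}) ⊗_K B`, which is induced by
`r : τ X ×_K B → X`, and of the base change of `ν`. -/
noncomputable def interpolationPoint (P : Prolongation s e X) (J : JetSpace m X)
    {T : Over (Spec K)} (p : T ⟶ P.obj) (ν : CoJetHom m P.obj p.left) :
    (twist s e).obj T ⟶ J.toOver :=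
  J.desc ((twist s e).map p ≫ P.canonical)
    ((ν.baseChange s).push e P.canonical.left (Over.w P.canonical) rfl)

/-- The interpolating map `φ : Jet^m (τ X) → τ (Jet^m X)`. -/
noncomputable def interpolation (P : Prolongation s e X) (JP : JetSpace m P.obj)
    (J : JetSpace m X) (P' : Prolongation s e J.toOver) : JP.toOver ⟶ P'.obj :=
  (P'.pointEquiv JP.toOver).symm (interpolationPoint P J JP.proj JP.univ)

end Interpolation

section Points

variable {K B : CommRingCat.{u}} {s e : K ⟶ B} {X : Over (Spec K)} {m : ℕ}

theorem JetSpace.desc_congr (J : JetSpace m X) {T : Over (Spec K)} {p p' : T ⟶ X} (h : p = p')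
    (ν : CoJetHom m X p.left) (ν' : CoJetHom m X p'.left)
    (h' : ∀ U x, ν.toFun U x = Jets.res (by subst h; rfl) (ν'.toFun U x)) :
    J.desc p ν = J.desc p' ν' := by
  subst h
  congr 1
  ext U x
  exact (h' U x).trans (res_self _ _)

theorem JetSpace.desc_proj (J : JetSpace m X) {T : Over (Spec K)} (p : T ⟶ X)
    (ν : CoJetHom m X p.left) : J.desc p ν ≫ J.proj = p := by
  ext
  exact Over.w (J.rep.homEquiv.symm ν : Over.mk p.left ⟶ J.obj)

theorem JetSpace.univ_desc (J : JetSpace m X) {T : Over (Spec K)} (p : T ⟶ X)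
    (ν : CoJetHom m X p.left) :
    J.univ.comp (J.desc p ν).left (congrArg CommaMorphism.left (J.desc_proj p ν)) = ν := by
  have h := J.rep.homEquiv_comp (J.rep.homEquiv.symm ν : Over.mk p.left ⟶ J.obj) (𝟙 J.obj)
  rw [Category.comp_id] at h
  exact h.symm.trans (Equiv.apply_symm_apply J.rep.homEquiv _)

theorem JetSpace.comp_desc (J : JetSpace m X) {T T' : Over (Spec K)} (t : T' ⟶ T) (p : T ⟶ X)
    (ν : CoJetHom m X p.left) : t ≫ J.desc p ν = J.desc (t ≫ p) (ν.comp t.left rfl) := by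
  let t' : Over.mk (t ≫ p).left ⟶ Over.mk p.left := Over.homMk t.left rfl
  have h := J.rep.homEquiv_comp t' (J.rep.homEquiv.symm ν)
  have h' := (Equiv.symm_apply_eq _).2 (h.trans (congrArg ((jetFunctor m X).map t'.op)
    (Equiv.apply_symm_apply J.rep.homEquiv _))).symm
  ext
  exact (congrArg CommaMorphism.left h').symm

theorem CoJetHom.push_comp {X : Over (Spec K)} {Z : Over (Spec B)} {Y Y' : Scheme.{u}}
    {p : Y ⟶ Z.left} (μ : CoJetHom m Z p) (σ : K ⟶ B) (r : Z.left ⟶ X.left)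
    (hr : r ≫ X.hom = Z.hom ≫ Spec.map σ) {g : Y ⟶ X.left} (hg : p ≫ r = g) (f : Y' ⟶ Y)
    {g' : Y' ⟶ X.left} (hg' : f ≫ g = g') {p' : Y' ⟶ Z.left} (hp : f ≫ p = p')
    (hg'' : p' ≫ r = g') :
    (μ.push σ r hr hg).comp f hg' = (μ.comp f hp).push σ r hr hg'' := by
  subst hg hp hg'
  ext U x
  change (f.appLE _ _ _).hom (Jets.res _ (μ.toFun _ _)) = Jets.res _ ((f.appLE _ _ _).hom _)
  exact appLE_res _ _ _ _ _ _

theorem CoJetHom.push_baseChange {Y T : Over (Spec K)} {p : T ⟶ Y}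
    (ν : CoJetHom m Y p.left) (s : K ⟶ B) :
    (ν.baseChange s).push s (pullback.fst Y.hom (Spec.map s)) pullback.condition
      (pullback.lift_fst _ _ _) = ν.comp (pullback.fst T.hom (Spec.map s)) rfl :=
  (CoJetHom.existsUnique_baseChange (IsPullback.of_hasPullback Y.hom (Spec.map s)) _ _ _).choose_spec.1

theorem CoJetHom.baseChange_comp {Y T T' : Over (Spec K)} {p : T ⟶ Y} (t : T' ⟶ T)
    (ν : CoJetHom m Y p.left) (s : K ⟶ B) :
    (CoJetHom.comp ν t.left rfl : CoJetHom m Y (t ≫ p).left).baseChange s =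
      (ν.baseChange s).comp ((Over.pullback (Spec.map s)).map t).left (by
        rw [← Over.comp_left, ← Functor.map_comp]) := by
  refine (CoJetHom.existsUnique_baseChange (IsPullback.of_hasPullback Y.hom (Spec.map s))
    ((Over.pullback (Spec.map s)).map (t ≫ p)).left (pullback.lift_fst _ _ _) _).unique
    (CoJetHom.push_baseChange (p := t ≫ p) _ s) ?_
  have h₁ : ((Over.pullback (Spec.map s)).map t).left ≫ pullback.fst T.hom (Spec.map s) ≫ p.left =
      pullback.fst T'.hom (Spec.map s) ≫ (t ≫ p).left := by
    rw [← Category.assoc]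
    exact (congrArg (· ≫ p.left) (pullback.lift_fst _ _ _)).trans (Category.assoc _ _ _)
  refine (CoJetHom.push_comp (ν.baseChange s) s (pullback.fst Y.hom (Spec.map s))
    pullback.condition (pullback.lift_fst _ _ _) ((Over.pullback (Spec.map s)).map t).left
    h₁ _ _).symm.trans ?_
  rw [CoJetHom.push_baseChange]
  exact (CoJetHom.comp_comp _ _ _ _ _ (pullback.lift_fst _ _ _) rfl).trans
    (CoJetHom.comp_comp _ _ _ _ _ rfl rfl).symm

theorem interpolationPoint_congr (P : Prolongation s e X) (JP : JetSpace m P.obj)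
    (J : JetSpace m X) {T : Over (Spec K)} (t : T ⟶ JP.toOver) {p : T ⟶ P.obj}
    (hp : t ≫ JP.proj = p) {ν : CoJetHom m P.obj p.left}
    (hν : JP.univ.comp t.left (congrArg CommaMorphism.left hp) = ν) :
    interpolationPoint P J (t ≫ JP.proj) (JP.univ.comp t.left rfl) = interpolationPoint P J p ν := by
  subst hp
  subst hν
  rfl

theorem interpolationPoint_comp (P : Prolongation s e X) (J : JetSpace m X)
    {T T' : Over (Spec K)} (t : T' ⟶ T) (p : T ⟶ P.obj) (ν : CoJetHom m P.obj p.left) :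
    (twist s e).map t ≫ interpolationPoint P J p ν =
      interpolationPoint P J (t ≫ p) (ν.comp t.left rfl) := by
  rw [interpolationPoint, JetSpace.comp_desc]
  refine JetSpace.desc_congr J (by simp) _ _ fun U x => ?_
  rw [CoJetHom.baseChange_comp]
  have := CoJetHom.push_comp (ν.baseChange s) e P.canonical.left (Over.w P.canonical) rfl
    ((twist s e).map t).left (g' := ((twist s e).map t ≫ (twist s e).map p ≫ P.canonical).left) rfl
    (p' := ((Over.pullback (Spec.map s)).map (t ≫ p)).left)
    (by rw [Functor.map_comp]; rfl) (by rw [Functor.map_comp]; rfl)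
  refine (congrArg (fun z => z.toFun U x) this).trans ?_
  exact (res_res _ _ _).symm

/-- The interpolating map on points: `(p, ν) ↦ (p̂, v (u ν))`. -/
theorem desc_interpolation (P : Prolongation s e X) (JP : JetSpace m P.obj) (J : JetSpace m X)
    (P' : Prolongation s e J.toOver) {T : Over (Spec K)} (p : T ⟶ P.obj)
    (ν : CoJetHom m P.obj p.left) :
    P'.pointEquiv T (JP.desc p ν ≫ interpolation P JP J P') = interpolationPoint P J p ν := by
  have h : (P'.pointEquiv JP.toOver) (interpolation P JP J P') =
    interpolationPoint P J JP.proj JP.univ := Equiv.apply_symm_apply ..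
  rw [Prolongation.pointEquiv_apply, Functor.map_comp, Category.assoc,
    ← Prolongation.pointEquiv_apply, h, interpolationPoint_comp]
  exact interpolationPoint_congr P JP J _ (JP.desc_proj p ν) (JP.univ_desc p ν)

end Points

/-- A finite free algebra scheme over `A`, i.e. over the ring scheme `S = 𝔸¹` over `A`. Ring
schemes are given through their functors of points on `A`-algebras; the isomorphism `ψ` with `S ^ ℓ`
makes the functor representable by an affine space of dimension `ℓ` over `A`. -/
structure FiniteFreeAlgebraScheme (A : Type u) [CommRing A] where
  /-- The functor of points `R ↦ E(R)`. -/
  functor : CommAlgCat.{u} A ⥤ CommRingCat.{u}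
  /-- The structure morphism of ring schemes `S → E`. -/
  s : forget₂ (CommAlgCat.{u} A) CommRingCat.{u} ⟶ functor
  /-- The rank. -/
  ℓ : ℕ
  /-- The isomorphism of `S`-module schemes `E ≅ S ^ ℓ`. -/
  ψ (R : CommAlgCat.{u} A) : functor.obj R ≃+ (Fin ℓ → R)
  ψ_smul (R : CommAlgCat.{u} A) (a : R) (x : functor.obj R) :
    ψ R ((s.app R).hom a * x) = a • ψ R x
  ψ_map {R R' : CommAlgCat.{u} A} (g : R ⟶ R') (x : functor.obj R) (i : Fin ℓ) :
    ψ R' ((functor.map g).hom x) i = g.hom (ψ R x i)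

namespace FiniteFreeAlgebraScheme

variable {A : Type u} [CommRing A]

/-- A morphism of `S`-algebra schemes. -/
structure Hom (E F : FiniteFreeAlgebraScheme A) where
  /-- The underlying morphism of ring schemes. -/
  toNatTrans : E.functor ⟶ F.functor
  s_comp : E.s ≫ toNatTrans = F.s

/-- The `A`-algebra structure on `E(R)` induced by `s : R → E(R)`. -/
noncomputable instance algebra (E : FiniteFreeAlgebraScheme A) (R : CommAlgCat.{u} A) :
    Algebra A (E.functor.obj R) :=
  ((E.s.app R).hom.comp (algebraMap A R)).toAlgebra

/-- `R ↦ E(R)` as a functor to `A`-algebras. -/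
noncomputable def alg (E : FiniteFreeAlgebraScheme A) : CommAlgCat.{u} A ⥤ CommAlgCat.{u} A where
  obj R := CommAlgCat.of A (E.functor.obj R)
  map {R R'} g := CommAlgCat.ofHom
    { (E.functor.map g).hom with
      commutes' := fun a => by
        have h := RingHom.congr_fun (congrArg CommRingCat.Hom.hom (E.s.naturality g))
          (algebraMap A R a)
        exact h.symm.trans (congrArg (E.s.app R').hom (g.hom.commutes a)) }
  map_id R := by
    ext x
    exact RingHom.congr_fun (congrArg CommRingCat.Hom.hom (E.functor.map_id R)) x
  map_comp g g' := by
    ext x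
    exact RingHom.congr_fun (congrArg CommRingCat.Hom.hom (E.functor.map_comp g g')) x

/-- The composite `EF`, with `EF(R) = E(F(R))`. -/
noncomputable def comp (E F : FiniteFreeAlgebraScheme A) : FiniteFreeAlgebraScheme A where
  functor := F.alg ⋙ E.functor
  s :=
    { app := fun R => F.s.app R ≫ E.s.app (F.alg.obj R)
      naturality := fun R R' g => CommRingCat.hom_ext <| RingHom.ext fun x =>
        (congrArg (E.s.app (F.alg.obj R')).hom
          (RingHom.congr_fun (congrArg CommRingCat.Hom.hom (F.s.naturality g)) x)).trans
        (RingHom.congr_fun (congrArg CommRingCat.Hom.hom (E.s.naturality (F.alg.map g)))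
          ((F.s.app R).hom x)) }
  ℓ := E.ℓ * F.ℓ
  ψ R := (E.ψ (F.alg.obj R)).trans
    { toFun := fun x i => F.ψ R (x (finProdFinEquiv.symm i).1) (finProdFinEquiv.symm i).2
      invFun := fun y i => (F.ψ R).symm fun j => y (finProdFinEquiv (i, j))
      left_inv := fun x => by
        funext i
        simpa using! (F.ψ R).symm_apply_apply (x i)
      right_inv := fun y => by
        funext i
        simpa using! congrArg y (finProdFinEquiv.apply_symm_apply i)
      map_add' := fun x y => by
        ext i
        exact congrFun (map_add (F.ψ R) _ _) _ }
  ψ_smul R a x := by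
    ext i
    have h := congrFun (E.ψ_smul (F.alg.obj R) ((F.s.app R).hom a) x) (finProdFinEquiv.symm i).1
    exact congrFun ((congrArg (F.ψ R) h).trans (F.ψ_smul R a _)) _
  ψ_map {R R'} g x i :=
    (congrArg (fun z => F.ψ R' z (finProdFinEquiv.symm i).2)
      (E.ψ_map (F.alg.map g) x (finProdFinEquiv.symm i).1)).trans (F.ψ_map g _ _)

/-- The ring underlying `k`. -/
abbrev base (k : CommAlgCat.{u} A) : CommRingCat.{u} :=
  (forget₂ (CommAlgCat.{u} A) CommRingCat.{u}).obj k

/-- The ring homomorphism underlying an `E`-ring structure `e : k → E(k)`. -/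
noncomputable def ringHom (E : FiniteFreeAlgebraScheme A) {k : CommAlgCat.{u} A}
    (e : k ⟶ E.alg.obj k) : base k ⟶ E.functor.obj k :=
  (forget₂ (CommAlgCat.{u} A) CommRingCat.{u}).map e

/-- The `EF`-ring structure `ef = E(f) ∘ e` on `k`. -/
noncomputable def compRing {E F : FiniteFreeAlgebraScheme A} {k : CommAlgCat.{u} A}
    (e : k ⟶ E.alg.obj k) (f : k ⟶ F.alg.obj k) : k ⟶ (E.comp F).alg.obj k :=
  CommAlgCat.ofHom { (e ≫ E.alg.map f).hom with commutes' := (e ≫ E.alg.map f).hom.commutes }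

/-- A prolongation space `τ(X, E, e)`. -/
abbrev Prolongation (E : FiniteFreeAlgebraScheme A) {k : CommAlgCat.{u} A} (e : k ⟶ E.alg.obj k)
    (X : Over (Spec (base k))) : Type (u + 1) :=
  Jets.Prolongation (E.s.app k) (E.ringHom e) X

/-- The identification `τ(τ(X, E, e), F, f) → τ(X, EF, ef)`. -/
noncomputable def collapse {E F : FiniteFreeAlgebraScheme A} {k : CommAlgCat.{u} A}
    {e : k ⟶ E.alg.obj k} {f : k ⟶ F.alg.obj k} {X : Over (Spec (base k))}
    (P : E.Prolongation e X) (Q : F.Prolongation f P.obj)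
    (R : (E.comp F).Prolongation (compRing e f) X) : Q.obj ⟶ R.obj :=
  Jets.Prolongation.collapse P Q R (E.functor.map f) (E.s.app (F.alg.obj k)) rfl
    (E.s.naturality f) rfl

/-- The comparison morphism `α̂ : τ(X, E, e) → τ(X, F, f)` for `α : E → F` with `α ∘ e = f`. -/
noncomputable def comparison {E F : FiniteFreeAlgebraScheme A} {k : CommAlgCat.{u} A}
    {e : k ⟶ E.alg.obj k} {f : k ⟶ F.alg.obj k} {X : Over (Spec (base k))} (α : E.Hom F)
    (hα : E.ringHom e ≫ α.toNatTrans.app k = F.ringHom f) (P : E.Prolongation e X)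
    (Q : F.Prolongation f X) : P.obj ⟶ Q.obj :=
  Jets.Prolongation.comparison P Q (α.toNatTrans.app k) (NatTrans.congr_app α.s_comp k) hα

end FiniteFreeAlgebraScheme

end Jets

open Jets

open Jets.FiniteFreeAlgebraScheme (base compRing collapse comparison)

/-!
Everything is checked on points. A morphism out of `Jet^m (τ X)` is determined by its values on the
points `(p, ν)` (`JetSpace.hom_ext`), and a `T`-point of a prolongation space is a morphism
`T ×_K B → X`. In these terms `τ(g)` is composition with `g`, the comparison morphism is
precomposition with `T ×_K B' → T ×_K B`, and the morphism `τ' τ X → τ'' X` is precomposition with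
`T ×_K B'' → (T ×_K B') ×_K B`; see `Prolongation.pointEquiv_map`,
`Prolongation.pointEquiv_comparison` and `Prolongation.pointEquiv_collapse`.

Since the interpolating map sends `(p, ν)` to `(p̂, v (u ν))`, with `u` base change and `v` the
restriction along `r`, each of the three identities reduces to a compatibility of base change of
co-jet homomorphisms: with the map of co-jets induced by a morphism
(`CoJetHom.baseChange_push`), with a change of the base ring
(`CoJetHom.baseChange_push_baseChangeMap`), and with base change in two steps
(`CoJetHom.baseChange_baseChange`). All three follow from the uniqueness of the extension of a
homomorphism `g^* coJ_Y → 𝒪` to the co-jets of `Y ×_K B` over `B` (`CoJetHom.ext_of_push_fst`): both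
sides have the same restriction to `coJ_Y`.

The morphism `τ' τ X → τ'' X` is an isomorphism because `B''` is the pushout of `B` and `B'` over
`K`, so that `T ×_K B'' → (T ×_K B') ×_K B` is an isomorphism for all `T`. For finite free algebra
schemes this says that `E(R')` is the base change of `E(R)` along `R → R'`: both are free, on the
same coordinates (`FiniteFreeAlgebraScheme.isPushout`).
-/

namespace Jets

/-! ### Homomorphisms out of co-jets -/

section CoJetHoms

variable {K K' K'' : CommRingCat.{u}} {m : ℕ}

theorem CoJetHom.push_push {X : Over (Spec K)} {Z : Over (Spec K')} {Z' : Over (Spec K'')}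
    {Y : Scheme.{u}} {p' : Y ⟶ Z'.left} (μ : CoJetHom m Z' p') {σ' : K' ⟶ K''}
    {r' : Z'.left ⟶ Z.left} (hr' : r' ≫ Z.hom = Z'.hom ≫ Spec.map σ') {p : Y ⟶ Z.left}
    (hp : p' ≫ r' = p) {σ : K ⟶ K'} {r : Z.left ⟶ X.left}
    (hr : r ≫ X.hom = Z.hom ≫ Spec.map σ) {g : Y ⟶ X.left} (hg : p ≫ r = g) {σ'' : K ⟶ K''}
    (hσ : σ ≫ σ' = σ'') {r'' : Z'.left ⟶ X.left} (hr'' : r' ≫ r = r'')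
    (h : r'' ≫ X.hom = Z'.hom ≫ Spec.map σ'') (hg' : p' ≫ r'' = g) :
    (μ.push σ' r' hr' hp).push σ r hr hg = μ.push σ'' r'' h hg' := by
  subst hr''
  ext U x
  rw [push_toFun, push_toFun, push_toFun, res_res]
  exact congrArg (fun z => res _ (μ.toFun _ z))
    (coJetMap_comp m hσ rfl hr hr' h le_rfl le_rfl le_rfl x)

/-- Homomorphisms out of the co-jets of a base change `Y ×_K B` over `B` are determined by their
restriction to the co-jets of `Y`. -/
theorem CoJetHom.ext_of_push_fst {B : CommRingCat.{u}} {s : K ⟶ B} {Y : Over (Spec K)}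
    {T : Scheme.{u}} {p : T ⟶ ((Over.pullback (Spec.map s)).obj Y).left}
    {g : T ⟶ Y.left} (hg : p ≫ pullback.fst Y.hom (Spec.map s) = g)
    {μ μ' : CoJetHom m ((Over.pullback (Spec.map s)).obj Y) p}
    (h : μ.push s (pullback.fst Y.hom (Spec.map s)) pullback.condition hg =
      μ'.push s (pullback.fst Y.hom (Spec.map s)) pullback.condition hg) : μ = μ' :=
  (CoJetHom.existsUnique_baseChange (IsPullback.of_hasPullback Y.hom (Spec.map s)) p hg _).unique
    h rfl

theorem JetSpace.desc_push_congr {X : Over (Spec K)} (J : JetSpace m X) {T : Over (Spec K)}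
    {Z : Over (Spec K')} {q : T.left ⟶ Z.left} (μ : CoJetHom m Z q) {p p' : T ⟶ X} (hp : p = p')
    {σ σ' : K ⟶ K'} (hσ : σ = σ') {r r' : Z.left ⟶ X.left} (hr : r = r')
    (h : r ≫ X.hom = Z.hom ≫ Spec.map σ) (hg : q ≫ r = p.left)
    (h' : r' ≫ X.hom = Z.hom ≫ Spec.map σ') (hg' : q ≫ r' = p'.left) :
    J.desc p (μ.push σ r h hg) = J.desc p' (μ.push σ' r' h' hg') := by
  subst hp hσ hr
  rfl

/-- `Jet^m g` on points: `(p, ν) ↦ (g ∘ p, ν ∘ dg)`. -/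
theorem JetSpace.desc_map {X Y : Over (Spec K)} (J : JetSpace m X) (J' : JetSpace m Y)
    (g : X ⟶ Y) {T : Over (Spec K)} (p : T ⟶ X) (ν : CoJetHom m X p.left) :
    J.desc p ν ≫ J.map J' g =
      J'.desc (p ≫ g) (ν.push (𝟙 K) g.left (by simp) rfl) := by
  rw [JetSpace.map, JetSpace.comp_desc]
  have h : (J.desc p ν).left ≫ J.proj.left = p.left :=
    congrArg CommaMorphism.left (J.desc_proj p ν)
  have h' : p.left ≫ g.left = (J.desc p ν ≫ J.proj ≫ g).left := by
    rw [← Category.assoc, J.desc_proj]; rfl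
  rw [CoJetHom.push_comp J.univ (𝟙 K) g.left (by simp) rfl (J.desc p ν).left rfl h h',
    J.univ_desc]
  exact J'.desc_push_congr ν (by rw [← Category.assoc, J.desc_proj]) rfl rfl _ _ _ _

/-- Base change of co-jet homomorphisms commutes with the map of co-jets induced by `g`. -/
theorem CoJetHom.baseChange_push {B : CommRingCat.{u}} (s : K ⟶ B) {T Y Y' : Over (Spec K)}
    {p : T ⟶ Y} (ν : CoJetHom m Y p.left) (g : Y ⟶ Y') {q : T ⟶ Y'} (hq : p ≫ g = q) :
    (ν.push (𝟙 K) g.left (by simp) (by rw [← Over.comp_left, hq]) :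
      CoJetHom m Y' q.left).baseChange s =
      (ν.baseChange s).push (𝟙 B) ((Over.pullback (Spec.map s)).map g).left
        (by rw [Spec.map_id, Category.comp_id]; exact Over.w _)
        (by rw [← Over.comp_left, ← Functor.map_comp, hq]) := by
  subst hq
  refine CoJetHom.ext_of_push_fst (pullback.lift_fst _ _ _) ?_
  have hfst : ((Over.pullback (Spec.map s)).map g).left ≫ pullback.fst Y'.hom (Spec.map s) =
    pullback.fst Y.hom (Spec.map s) ≫ g.left := pullback.lift_fst _ _ _
  have h₀ : ((Over.pullback (Spec.map s)).map p).left ≫ pullback.fst Y.hom (Spec.map s) =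
    pullback.fst T.hom (Spec.map s) ≫ p.left := pullback.lift_fst _ _ _
  have hc : (pullback.fst Y.hom (Spec.map s) ≫ g.left) ≫ Y'.hom =
      pullback.snd Y.hom (Spec.map s) ≫ Spec.map s := by
    rw [Category.assoc, Over.w g, pullback.condition]
  have hd : ((Over.pullback (Spec.map s)).map p).left ≫ pullback.fst Y.hom (Spec.map s) ≫ g.left =
      pullback.fst T.hom (Spec.map s) ≫ (p ≫ g).left := by
    rw [← Category.assoc, h₀, Category.assoc]; rfl
  refine (CoJetHom.push_baseChange (p := p ≫ g) _ s).trans ?_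
  refine Eq.trans ?_ (CoJetHom.push_push (ν.baseChange s) _ _ _ _ (Category.comp_id s) hfst hc
    hd).symm
  rw [CoJetHom.push_comp ν (𝟙 K) g.left (by simp) rfl (pullback.fst T.hom (Spec.map s)) rfl rfl
    (Category.assoc _ _ _), ← CoJetHom.push_baseChange]
  exact CoJetHom.push_push (ν.baseChange s) _ _ _ _ (Category.id_comp s) rfl _ _

variable {B B' B'' : CommRingCat.{u}} {s e : K ⟶ B} {s' e' : K ⟶ B'} {s'' e'' : K ⟶ B''}

/-- The morphism `T ×_K B' → T ×_K B` induced by `α : B → B'`. -/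
noncomputable def baseChangeMap (α : B ⟶ B') (hs : s ≫ α = s') (T : Over (Spec K)) :
    ((Over.pullback (Spec.map s')).obj T).left ⟶ ((Over.pullback (Spec.map s)).obj T).left :=
  pullback.lift (pullback.fst T.hom (Spec.map s')) (pullback.snd T.hom (Spec.map s') ≫ Spec.map α)
    (by rw [pullback.condition, Category.assoc, ← Spec.map_comp, hs])

theorem baseChangeMap_fst (α : B ⟶ B') (hs : s ≫ α = s') (T : Over (Spec K)) :
    baseChangeMap α hs T ≫ pullback.fst T.hom (Spec.map s) = pullback.fst T.hom (Spec.map s') :=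
  pullback.lift_fst _ _ _

theorem baseChangeMap_snd (α : B ⟶ B') (hs : s ≫ α = s') (T : Over (Spec K)) :
    baseChangeMap α hs T ≫ pullback.snd T.hom (Spec.map s) =
      pullback.snd T.hom (Spec.map s') ≫ Spec.map α :=
  pullback.lift_snd _ _ _

theorem pullback_map_fst {T T' : Over (Spec K)} (t : T' ⟶ T) :
    ((Over.pullback (Spec.map s)).map t).left ≫ pullback.fst T.hom (Spec.map s) =
      pullback.fst T'.hom (Spec.map s) ≫ t.left :=
  pullback.lift_fst _ _ _

theorem pullback_map_snd {T T' : Over (Spec K)} (t : T' ⟶ T) :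
    ((Over.pullback (Spec.map s)).map t).left ≫ pullback.snd T.hom (Spec.map s) =
      pullback.snd T'.hom (Spec.map s) :=
  pullback.lift_snd _ _ _

theorem baseChangeMap_naturality (α : B ⟶ B') (hs : s ≫ α = s') {T T' : Over (Spec K)}
    (t : T' ⟶ T) :
    ((Over.pullback (Spec.map s')).map t).left ≫ baseChangeMap α hs T =
      baseChangeMap α hs T' ≫ ((Over.pullback (Spec.map s)).map t).left := by
  refine pullback.hom_ext ?_ ?_
  · rw [Category.assoc, Category.assoc, baseChangeMap_fst, pullback_map_fst, pullback_map_fst,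
      ← Category.assoc, baseChangeMap_fst]
  · rw [Category.assoc, Category.assoc, baseChangeMap_snd, pullback_map_snd, baseChangeMap_snd,
      ← Category.assoc, pullback_map_snd]

theorem twist_map_fst {T T' : Over (Spec K)} (t : T' ⟶ T) :
    ((twist s e).map t).left ≫ pullback.fst T.hom (Spec.map s) =
      pullback.fst T'.hom (Spec.map s) ≫ t.left :=
  pullback.lift_fst _ _ _

theorem twist_map_snd {T T' : Over (Spec K)} (t : T' ⟶ T) :
    ((twist s e).map t).left ≫ pullback.snd T.hom (Spec.map s) =
      pullback.snd T'.hom (Spec.map s) :=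
  pullback.lift_snd _ _ _

theorem twist_hom_ext {T Z : Over (Spec K)} {a b : Z ⟶ (twist s e).obj T}
    (h₁ : a.left ≫ pullback.fst T.hom (Spec.map s) = b.left ≫ pullback.fst T.hom (Spec.map s))
    (h₂ : a.left ≫ pullback.snd T.hom (Spec.map s) = b.left ≫ pullback.snd T.hom (Spec.map s)) :
    a = b :=
  Over.OverMorphism.ext (pullback.hom_ext h₁ h₂)

theorem twistMap_naturality (α : B ⟶ B') (hs : s ≫ α = s') (he : e ≫ α = e')
    {T T' : Over (Spec K)} (t : T' ⟶ T) :
    (twist s' e').map t ≫ twistMap α hs he T = twistMap α hs he T' ≫ (twist s e).map t :=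
  Over.OverMorphism.ext (baseChangeMap_naturality α hs t)

/-- The base changes of `ν` to `B` and to `B'` are compatible with a homomorphism `α : B → B'`. -/
theorem CoJetHom.baseChange_push_baseChangeMap (α : B ⟶ B') (hs : s ≫ α = s')
    {T Y : Over (Spec K)} {p : T ⟶ Y} (ν : CoJetHom m Y p.left)
    {q : ((Over.pullback (Spec.map s')).obj T).left ⟶ ((Over.pullback (Spec.map s)).obj Y).left}
    (hq : ((Over.pullback (Spec.map s')).map p).left ≫ baseChangeMap α hs Y = q)
    (hq' : baseChangeMap α hs T ≫ ((Over.pullback (Spec.map s)).map p).left = q) :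
    (ν.baseChange s').push α (baseChangeMap α hs Y) (baseChangeMap_snd α hs Y) hq =
      (ν.baseChange s).comp (baseChangeMap α hs T) hq' := by
  subst hq
  have h₀ : ((Over.pullback (Spec.map s)).map p).left ≫ pullback.fst Y.hom (Spec.map s) =
    pullback.fst T.hom (Spec.map s) ≫ p.left := pullback.lift_fst _ _ _
  have h₀' : ((Over.pullback (Spec.map s')).map p).left ≫ pullback.fst Y.hom (Spec.map s') =
    pullback.fst T.hom (Spec.map s') ≫ p.left := pullback.lift_fst _ _ _
  have hg : (((Over.pullback (Spec.map s')).map p).left ≫ baseChangeMap α hs Y) ≫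
      pullback.fst Y.hom (Spec.map s) = pullback.fst T.hom (Spec.map s') ≫ p.left := by
    rw [Category.assoc, baseChangeMap_fst, h₀']
  have hf : baseChangeMap α hs T ≫ pullback.fst T.hom (Spec.map s) ≫ p.left =
      pullback.fst T.hom (Spec.map s') ≫ p.left := by
    rw [← Category.assoc, baseChangeMap_fst]
  refine CoJetHom.ext_of_push_fst hg ?_
  refine (CoJetHom.push_push (Z := (Over.pullback (Spec.map s)).obj Y)
    (ν.baseChange s') (baseChangeMap_snd α hs Y) rfl pullback.condition hg
    hs (baseChangeMap_fst α hs Y) pullback.condition h₀').trans ?_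
  rw [CoJetHom.push_baseChange,
    ← CoJetHom.push_comp (ν.baseChange s) s (pullback.fst Y.hom (Spec.map s)) pullback.condition
      h₀ (baseChangeMap α hs T) hf hq' hg, CoJetHom.push_baseChange]
  exact (CoJetHom.comp_comp ν _ rfl _ hf (baseChangeMap_fst α hs T) rfl).symm

end CoJetHoms

/-! ### Points of prolongation spaces -/

section Prolongations

variable {K B B' B'' : CommRingCat.{u}} {s e : K ⟶ B} {s' e' : K ⟶ B'} {s'' e'' : K ⟶ B''}
  {X Y : Over (Spec K)} {m : ℕ}

namespace Prolongation

theorem pointEquiv_comp (P : Prolongation s e X) {T T' : Over (Spec K)} (t : T' ⟶ T)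
    (p : T ⟶ P.obj) : P.pointEquiv T' (t ≫ p) = (twist s e).map t ≫ P.pointEquiv T p := by
  rw [pointEquiv_apply, pointEquiv_apply, Functor.map_comp, Category.assoc]

/-- `τ(g)` on points is composition with `g`. -/
theorem pointEquiv_map (P : Prolongation s e X) (Q : Prolongation s e Y) (g : X ⟶ Y)
    {T : Over (Spec K)} (p : T ⟶ P.obj) :
    Q.pointEquiv T (p ≫ Prolongation.map P Q g) = P.pointEquiv T p ≫ g := by
  have h : Q.pointEquiv P.obj (Prolongation.map P Q g) = P.canonical ≫ g := by
    refine (congrArg ((Over.mapPullbackAdj (Spec.map e)).homEquiv _ _).symm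
      (Equiv.apply_symm_apply Q.rep.homEquiv _)).trans ?_
    exact Adjunction.homEquiv_naturality_right_symm ..
  rw [pointEquiv_comp, h, ← Category.assoc, ← pointEquiv_apply]

/-- `α̂` on points is precomposition with `T ×_K B' → T ×_K B`. -/
theorem pointEquiv_comparison (P : Prolongation s e X) (P' : Prolongation s' e' X) (α : B ⟶ B')
    (hs : s ≫ α = s') (he : e ≫ α = e') {T : Over (Spec K)} (p : T ⟶ P.obj) :
    P'.pointEquiv T (p ≫ Prolongation.comparison P P' α hs he) =
      twistMap α hs he T ≫ P.pointEquiv T p := by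
  rw [pointEquiv_comp, Prolongation.comparison, Equiv.apply_symm_apply, ← Category.assoc,
    twistMap_naturality, Category.assoc, ← pointEquiv_apply]

end Prolongation

/-- The morphism `T ×_K B'' → (T ×_K B') ×_K B` given by `j : B' → B''` and `i : B → B''`, where
`T ×_K B'` is regarded as a scheme over `K` through `e'`. -/
noncomputable def twistSplit (i : B ⟶ B'') (j : B' ⟶ B'') (h₁ : s' ≫ j = s'')
    (h₂ : e' ≫ j = s ≫ i) (h₃ : e ≫ i = e'') (T : Over (Spec K)) :
    (twist s'' e'').obj T ⟶ (twist s e).obj ((twist s' e').obj T) :=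
  Over.homMk
    (pullback.lift (f := pullback.snd T.hom (Spec.map s') ≫ Spec.map e') (g := Spec.map s)
      (baseChangeMap j h₁ T) (pullback.snd T.hom (Spec.map s'') ≫ Spec.map i)
      (by
        rw [← Category.assoc, baseChangeMap_snd, Category.assoc, Category.assoc, ← Spec.map_comp,
          ← Spec.map_comp, h₂]))
    (show pullback.lift _ _ _ ≫ pullback.snd (pullback.snd T.hom (Spec.map s') ≫ Spec.map e')
          (Spec.map s) ≫ Spec.map e = pullback.snd T.hom (Spec.map s'') ≫ Spec.map e'' by
        rw [pullback.lift_snd_assoc, Category.assoc, ← Spec.map_comp, h₃])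

section Split

variable (i : B ⟶ B'') (j : B' ⟶ B'') (h₁ : s' ≫ j = s'') (h₂ : e' ≫ j = s ≫ i)
  (h₃ : e ≫ i = e'')

theorem twistSplit_fst (T : Over (Spec K)) :
    (twistSplit i j h₁ h₂ h₃ T).left ≫
        pullback.fst ((twist s' e').obj T).hom (Spec.map s) =
      baseChangeMap j h₁ T :=
  pullback.lift_fst _ _ _

theorem twistSplit_snd (T : Over (Spec K)) :
    (twistSplit i j h₁ h₂ h₃ T).left ≫
        pullback.snd ((twist s' e').obj T).hom (Spec.map s) =
      pullback.snd T.hom (Spec.map s'') ≫ Spec.map i :=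
  pullback.lift_snd _ _ _

theorem twistSplit_naturality {T T' : Over (Spec K)} (t : T' ⟶ T) :
    (twist s'' e'').map t ≫ twistSplit i j h₁ h₂ h₃ T =
      twistSplit i j h₁ h₂ h₃ T' ≫ (twist s e).map ((twist s' e').map t) := by
  refine twist_hom_ext ?_ ?_
  · rw [Over.comp_left, Over.comp_left, Category.assoc, Category.assoc, twistSplit_fst,
      twist_map_fst, ← Category.assoc, twistSplit_fst]
    exact baseChangeMap_naturality j h₁ t
  · rw [Over.comp_left, Over.comp_left, Category.assoc, Category.assoc, twistSplit_snd,
      twist_map_snd, twistSplit_snd, ← Category.assoc, twist_map_snd]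

/-- If `B''` is the pushout of `B'` and `B` over `K`, then
`T ×_K B'' → (T ×_K B') ×_K B` is an isomorphism. -/
theorem isIso_twistSplit (h : IsPushout e' s j i) (T : Over (Spec K)) :
    IsIso (twistSplit i j h₁ h₂ h₃ T) := by
  have hl : IsPullback
      (baseChangeMap j h₁ T)
      (pullback.snd T.hom (Spec.map s'')) (pullback.snd T.hom (Spec.map s')) (Spec.map j) := by
    refine IsPullback.of_right (h₁₂ := pullback.fst T.hom (Spec.map s')) (h₂₂ := Spec.map s')
      (v₁₃ := T.hom) ?_ (baseChangeMap_snd _ _ _) (IsPullback.of_hasPullback _ _)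
    rw [baseChangeMap_fst, ← Spec.map_comp, h₁]
    exact IsPullback.of_hasPullback _ _
  have hp := hl.paste_vert (isPullback_SpecMap_of_isPushout _ _ _ _ h)
  have : IsIso (twistSplit i j h₁ h₂ h₃ T).left := by
    have : (twistSplit i j h₁ h₂ h₃ T).left = hp.isoPullback.hom := by
      refine pullback.hom_ext ?_ ?_
      · exact (twistSplit_fst i j h₁ h₂ h₃ T).trans hp.isoPullback_hom_fst.symm
      · exact (twistSplit_snd i j h₁ h₂ h₃ T).trans hp.isoPullback_hom_snd.symm
    rw [this]
    infer_instance
  have : IsIso ((Over.forget _).map (twistSplit i j h₁ h₂ h₃ T)) := this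
  exact isIso_of_reflects_iso _ (Over.forget _)

/-- The morphism `τ' τ X → τ'' X` on points is precomposition with
`T ×_K B'' → (T ×_K B') ×_K B`. -/
theorem Prolongation.pointEquiv_collapse (P : Prolongation s e X) (Q : Prolongation s' e' P.obj)
    (R : Prolongation s'' e'' X) {T : Over (Spec K)} (q : T ⟶ Q.obj) :
    R.pointEquiv T (q ≫ Prolongation.collapse P Q R i j h₁ h₂ h₃) =
      twistSplit i j h₁ h₂ h₃ T ≫ P.pointEquiv _ (Q.pointEquiv T q) := by
  have h : R.pointEquiv Q.obj (Prolongation.collapse P Q R i j h₁ h₂ h₃) =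
      twistSplit i j h₁ h₂ h₃ Q.obj ≫ (twist s e).map Q.canonical ≫ P.canonical := by
    refine (Equiv.apply_symm_apply (R.pointEquiv Q.obj) _).trans ?_
    rw [← Category.assoc]
    refine congrArg (· ≫ P.canonical) (twist_hom_ext ?_ ?_)
    · refine (pullback.lift_fst _ _ _).trans (Eq.symm ?_)
      rw [Over.comp_left, Category.assoc, twist_map_fst, ← Category.assoc, twistSplit_fst]
      rfl
    · refine (pullback.lift_snd _ _ _).trans (Eq.symm ?_)
      rw [Over.comp_left, Category.assoc, twist_map_snd, twistSplit_snd]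
  rw [pointEquiv_comp, h, ← Category.assoc, twistSplit_naturality, pointEquiv_apply P,
    pointEquiv_apply Q, Functor.map_comp]
  simp only [Category.assoc]

theorem Prolongation.isIso_collapse (P : Prolongation s e X) (Q : Prolongation s' e' P.obj)
    (R : Prolongation s'' e'' X) (h : IsPushout e' s j i) :
    IsIso (Prolongation.collapse P Q R i j h₁ h₂ h₃) := by
  refine isIso_of_yoneda_map_bijective _ fun T => ?_
  have := isIso_twistSplit i j h₁ h₂ h₃ h T
  have hb : Function.Bijective fun q : T ⟶ Q.obj =>
      R.pointEquiv T (q ≫ Prolongation.collapse P Q R i j h₁ h₂ h₃) := by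
    simp only [Prolongation.pointEquiv_collapse]
    exact ((asIso (twistSplit i j h₁ h₂ h₃ T)).homFromEquiv.symm.bijective.comp
      (P.pointEquiv _).bijective).comp (Q.pointEquiv T).bijective
  exact ((R.pointEquiv T).comp_bijective _).1 hb

end Split

end Prolongations

/-! ### Base change of finite free algebra schemes -/

section Pushout

/-- A commutative square of rings is a pushout if its vertical maps are free of the same finite
rank and its lower horizontal map respects coordinates. -/
theorem isPushout_of_coordinates {R S A B : CommRingCat.{u}} {f : R ⟶ S} {s : R ⟶ A} {t : S ⟶ B}
    {g : A ⟶ B} (w : f ≫ t = s ≫ g) {ι : Type*} [Finite ι] (ψ : A ≃+ (ι → R)) (ψ' : B ≃+ (ι → S))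
    (hψ : ∀ a x, ψ (s.hom a * x) = a • ψ x) (hψ' : ∀ a x, ψ' (t.hom a * x) = a • ψ' x)
    (h : ∀ x i, ψ' (g.hom x) i = f.hom (ψ x i)) : IsPushout f s t g := by
  classical
  have := Fintype.ofFinite ι
  let _ : Algebra R S := f.hom.toAlgebra
  let _ : Algebra R A := s.hom.toAlgebra
  let _ : Algebra S B := t.hom.toAlgebra
  let _ : Algebra A B := g.hom.toAlgebra
  let _ : Algebra R B := (f ≫ t).hom.toAlgebra
  have _ : IsScalarTower R S B := .of_algebraMap_eq fun _ => rfl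
  have _ : IsScalarTower R A B := .of_algebraMap_eq fun a =>
    RingHom.congr_fun (congrArg CommRingCat.Hom.hom w) a
  let b : Module.Basis ι R A := .ofEquivFun { ψ with
    map_smul' := fun a x => (congrArg ψ (Algebra.smul_def a x)).trans (hψ a x) }
  let b' : Module.Basis ι S B := .ofEquivFun { ψ' with
    map_smul' := fun a x => (congrArg ψ' (Algebra.smul_def a x)).trans (hψ' a x) }
  have hb (i : ι) : ψ (b i) = Pi.single i 1 := by
    have : b i = ψ.symm (Pi.single i 1) := by
      simp only [b, Module.Basis.coe_ofEquivFun]; rfl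
    rw [this, AddEquiv.apply_symm_apply]
  have hb' (i : ι) : ψ' (b' i) = Pi.single i 1 := by
    have : b' i = ψ'.symm (Pi.single i 1) := by
      simp only [b', Module.Basis.coe_ofEquivFun]; rfl
    rw [this, AddEquiv.apply_symm_apply]
  have hg (i : ι) : g.hom (b i) = b' i := by
    refine ψ'.injective (funext fun l => ?_)
    rw [h, hb, hb']
    by_cases hl : l = i
    · subst hl; simp
    · simp [hl]
  have _ : Algebra.IsPushout R S A B := ⟨by
    refine IsBaseChange.of_equiv ((Algebra.TensorProduct.basis S b).equiv b' (Equiv.refl ι)) ?_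
    refine fun x => LinearMap.congr_fun (f := ((((Algebra.TensorProduct.basis S b).equiv b'
      (Equiv.refl ι)).toLinearMap.restrictScalars R).comp
        ((TensorProduct.mk R S A) 1))) (b.ext fun i => ?_) x
    refine Eq.trans ?_ (hg i).symm
    have := (Algebra.TensorProduct.basis S b).equiv_apply i b' (Equiv.refl ι)
    rwa [Algebra.TensorProduct.basis_apply] at this⟩
  exact CommRingCat.isPushout_of_isPushout R S A B

/-- For a homomorphism `R → R'` the canonical map `E(R) ⊗_R R' → E(R')` is an isomorphism. -/
theorem FiniteFreeAlgebraScheme.isPushout {A : Type u} [CommRing A]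
    (E : FiniteFreeAlgebraScheme A) {R R' : CommAlgCat.{u} A} (g : R ⟶ R') :
    IsPushout ((forget₂ (CommAlgCat.{u} A) CommRingCat.{u}).map g) (E.s.app R) (E.s.app R')
      (E.functor.map g) :=
  isPushout_of_coordinates (E.s.naturality g) (E.ψ R) (E.ψ R') (E.ψ_smul R) (E.ψ_smul R')
    (E.ψ_map g)

end Pushout

/-! ### The interpolating map -/

section Interpolations

variable {K B B' B'' : CommRingCat.{u}} {s e : K ⟶ B} {s' e' : K ⟶ B'} {s'' e'' : K ⟶ B''}
  {X Y : Over (Spec K)} {m : ℕ}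

theorem JetSpace.desc_proj_univ (J : JetSpace m X) : J.desc J.proj J.univ = 𝟙 J.toOver := by
  ext
  exact congrArg (fun F : J.obj ⟶ J.obj => F.left)
    (Equiv.symm_apply_apply J.rep.homEquiv (𝟙 J.obj))

/-- Morphisms out of a jet space are determined by their values on the points `(p, ν)`. -/
theorem JetSpace.hom_ext (J : JetSpace m X) {Z : Over (Spec K)} {a b : J.toOver ⟶ Z}
    (h : ∀ (T : Over (Spec K)) (p : T ⟶ X) (ν : CoJetHom m X p.left),
      J.desc p ν ≫ a = J.desc p ν ≫ b) : a = b := by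
  have := h _ J.proj J.univ
  rwa [J.desc_proj_univ, Category.id_comp, Category.id_comp] at this

theorem twist_map_comp_canonical_map (P : Prolongation s e X) (Q : Prolongation s e Y)
    (g : X ⟶ Y) :
    (twist s e).map (Prolongation.map P Q g) ≫ Q.canonical = P.canonical ≫ g := by
  have := P.pointEquiv_map Q g (𝟙 _)
  rwa [Category.id_comp, Prolongation.pointEquiv_apply] at this

theorem twist_map_comp_canonical_comparison (P : Prolongation s e X) (P' : Prolongation s' e' X)
    (α : B ⟶ B') (hs : s ≫ α = s') (he : e ≫ α = e') :
    (twist s' e').map (Prolongation.comparison P P' α hs he) ≫ P'.canonical =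
      twistMap α hs he P.obj ≫ P.canonical := by
  have := P.pointEquiv_comparison P' α hs he (𝟙 _)
  rwa [Category.id_comp, Prolongation.pointEquiv_apply] at this

theorem twist_map_comp_canonical_collapse (P : Prolongation s e X)
    (Q : Prolongation s' e' P.obj) (R : Prolongation s'' e'' X) (i : B ⟶ B'') (j : B' ⟶ B'')
    (h₁ : s' ≫ j = s'') (h₂ : e' ≫ j = s ≫ i) (h₃ : e ≫ i = e'') :
    (twist s'' e'').map (Prolongation.collapse P Q R i j h₁ h₂ h₃) ≫ R.canonical =
      twistSplit i j h₁ h₂ h₃ Q.obj ≫ (twist s e).map Q.canonical ≫ P.canonical := by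
  have := P.pointEquiv_collapse i j h₁ h₂ h₃ Q R (𝟙 _)
  rwa [Category.id_comp, Prolongation.pointEquiv_apply, P.pointEquiv_apply] at this

/-- The value of the interpolating map at the image of `(p, ν)` under `Jet^m (g)`, for a morphism
`g : Z → τ X` corresponding to `c : Z ×_K B → X`, depends only on `c`. -/
theorem interpolationPoint_push (P : Prolongation s e X) (J : JetSpace m X)
    {T Z : Over (Spec K)} (p : T ⟶ Z) (g : Z ⟶ P.obj) (ν : CoJetHom m Z p.left)
    {c : (twist s e).obj Z ⟶ X} (hc : (twist s e).map g ≫ P.canonical = c) :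
    interpolationPoint P J (p ≫ g) (ν.push (𝟙 K) g.left (by simp) rfl) =
      J.desc ((twist s e).map p ≫ c) ((ν.baseChange s).push e c.left (Over.w c) rfl) := by
  subst hc
  rw [interpolationPoint, CoJetHom.baseChange_push s ν g rfl]
  have hg : ((Over.pullback (Spec.map s)).map p).left ≫
      ((Over.pullback (Spec.map s)).map g).left ≫ P.canonical.left =
        ((twist s e).map (p ≫ g) ≫ P.canonical).left := by
    rw [Functor.map_comp, Category.assoc]; rfl
  refine (congrArg (J.desc _) (CoJetHom.push_push (ν.baseChange s) _ _
    (Over.w P.canonical) rfl (Category.comp_id e) rfl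
    (Over.w ((twist s e).map g ≫ P.canonical)) hg)).trans ?_
  exact J.desc_push_congr _ (by rw [Functor.map_comp, Category.assoc]) rfl rfl _ _ _ _

/-- The interpolating map is compatible, on points, with the morphisms induced by `g : X → Y`. -/
theorem interpolationPoint_map (P : Prolongation s e X) (J : JetSpace m X)
    (Q : Prolongation s e Y) (J' : JetSpace m Y) (g : X ⟶ Y) {T : Over (Spec K)}
    (p : T ⟶ P.obj) (ν : CoJetHom m P.obj p.left) :
    interpolationPoint P J p ν ≫ J.map J' g =
      interpolationPoint Q J' (p ≫ Prolongation.map P Q g)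
        (ν.push (𝟙 K) (Prolongation.map P Q g).left (by simp) rfl) := by
  rw [interpolationPoint_push Q J' p _ ν (twist_map_comp_canonical_map P Q g),
    interpolationPoint, JetSpace.desc_map]
  refine (congrArg (J'.desc _) (CoJetHom.push_push (ν.baseChange s) _ _ _ _
    (Category.id_comp e) rfl (Over.w (P.canonical ≫ g)) rfl)).trans ?_
  exact J'.desc_push_congr _ (Category.assoc _ _ _) rfl rfl _ _ _ _

/-- The interpolating map is compatible, on points, with a change of the base ring `α : B → B'`. -/
theorem interpolationPoint_comparison (P : Prolongation s e X) (P' : Prolongation s' e' X)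
    (J : JetSpace m X) (α : B ⟶ B') (hs : s ≫ α = s') (he : e ≫ α = e') {T : Over (Spec K)}
    (p : T ⟶ P.obj) (ν : CoJetHom m P.obj p.left) :
    twistMap α hs he T ≫ interpolationPoint P J p ν =
      interpolationPoint P' J (p ≫ Prolongation.comparison P P' α hs he)
        (ν.push (𝟙 K) (Prolongation.comparison P P' α hs he).left (by simp) rfl) := by
  rw [interpolationPoint_push P' J p _ ν (twist_map_comp_canonical_comparison P P' α hs he),
    interpolationPoint, JetSpace.comp_desc]
  have hn := congrArg CommaMorphism.left (twistMap_naturality α hs he p)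
  have hn' : ((twist s' e').map p ≫ twistMap α hs he P.obj).left ≫ P.canonical.left =
      (twistMap α hs he T ≫ (twist s e).map p ≫ P.canonical).left := by
    rw [twistMap_naturality]; simp
  refine (congrArg (J.desc _) ((CoJetHom.push_comp (ν.baseChange s) e P.canonical.left
    (Over.w P.canonical) rfl (twistMap α hs he T).left rfl hn.symm hn').trans
    ((congrArg (fun μ => CoJetHom.push μ e P.canonical.left (Over.w P.canonical) hn')
      (CoJetHom.baseChange_push_baseChangeMap α hs ν rfl hn.symm).symm).trans
    (CoJetHom.push_push (ν.baseChange s') (baseChangeMap_snd α hs P.obj) rfl (Over.w P.canonical)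
      hn' he rfl (Over.w (twistMap α hs he P.obj ≫ P.canonical)) hn')))).trans ?_
  exact J.desc_push_congr _ (by rw [← Category.assoc, ← twistMap_naturality, Category.assoc])
    rfl rfl _ _ _ _

/-- Base change along `s''` can be carried out in two steps: base change along `s'`, restriction
along `c : Z ×_K B' → Y`, and base change along `s` give the same as base change along `s''` and
restriction along `Z ×_K B'' → (Z ×_K B') ×_K B → Y ×_K B`. -/
theorem CoJetHom.baseChange_baseChange (i : B ⟶ B'') (j : B' ⟶ B'') (h₁ : s' ≫ j = s'')
    (h₂ : e' ≫ j = s ≫ i) (h₃ : e ≫ i = e'') {T Z : Over (Spec K)} {p : T ⟶ Z}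
    (ν : CoJetHom m Z p.left) (c : (twist s' e').obj Z ⟶ Y)
    (hs : (twistSplit i j h₁ h₂ h₃ Z ≫ (twist s e).map c).left ≫
      ((Over.pullback (Spec.map s)).obj Y).hom =
        ((Over.pullback (Spec.map s'')).obj Z).hom ≫ Spec.map i)
    {q : ((twist s'' e'').obj T).left ⟶ ((Over.pullback (Spec.map s)).obj Y).left}
    (hq : ((Over.pullback (Spec.map s'')).map p).left ≫
      (twistSplit i j h₁ h₂ h₃ Z ≫ (twist s e).map c).left = q)
    (hq' : (twistSplit i j h₁ h₂ h₃ T).left ≫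
      ((Over.pullback (Spec.map s)).map ((twist s' e').map p ≫ c)).left = q) :
    (CoJetHom.baseChange (p := (twist s' e').map p ≫ c)
      ((ν.baseChange s').push e' c.left (Over.w c) rfl) s).comp
        (twistSplit i j h₁ h₂ h₃ T).left hq' =
      (ν.baseChange s'').push i (twistSplit i j h₁ h₂ h₃ Z ≫ (twist s e).map c).left hs hq := by
  subst hq'
  -- both sides restrict on `coJ_Y` to `ν.baseChange s''` along `Z ×_K B'' → Z ×_K B' → Y`
  have hfst : (twistSplit i j h₁ h₂ h₃ Z ≫ (twist s e).map c).left ≫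
      pullback.fst Y.hom (Spec.map s) = baseChangeMap j h₁ Z ≫ c.left := by
    rw [Over.comp_left, Category.assoc, twist_map_fst, ← Category.assoc, twistSplit_fst]
  have hM : baseChangeMap j h₁ T ≫ ((twist s' e').map p).left =
      ((Over.pullback (Spec.map s'')).map p).left ≫ baseChangeMap j h₁ Z :=
    (baseChangeMap_naturality j h₁ p).symm
  have hw : (baseChangeMap j h₁ Z ≫ c.left) ≫ Y.hom =
      ((Over.pullback (Spec.map s'')).obj Z).hom ≫ Spec.map (e' ≫ j) := by
    rw [Category.assoc, Over.w c, Spec.map_comp]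
    refine (pullback.lift_snd_assoc _ _ _ _).trans (Category.assoc _ _ _)
  have h₄ : (twistSplit i j h₁ h₂ h₃ T).left ≫
      pullback.fst ((twist s' e').obj T).hom (Spec.map s) ≫ ((twist s' e').map p ≫ c).left =
        ((Over.pullback (Spec.map s'')).map p).left ≫ baseChangeMap j h₁ Z ≫ c.left := by
    rw [← Category.assoc, twistSplit_fst, Over.comp_left, ← Category.assoc]
    exact (congrArg (· ≫ c.left) hM).trans (Category.assoc _ _ _)
  have h₅ : ((twistSplit i j h₁ h₂ h₃ T).left ≫
      ((Over.pullback (Spec.map s)).map ((twist s' e').map p ≫ c)).left) ≫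
        pullback.fst Y.hom (Spec.map s) =
        ((Over.pullback (Spec.map s'')).map p).left ≫ baseChangeMap j h₁ Z ≫ c.left := by
    rw [← hq, Category.assoc, hfst]
  refine CoJetHom.ext_of_push_fst h₅ ?_
  refine Eq.trans ?_ (CoJetHom.push_push (Z := (Over.pullback (Spec.map s)).obj Y)
    (ν.baseChange s'') hs hq pullback.condition h₅ h₂.symm hfst hw rfl).symm
  let ν' : CoJetHom m Y ((twist s' e').map p ≫ c).left :=
    (ν.baseChange s').push e' c.left (Over.w c) rfl
  refine (CoJetHom.push_comp (Z := (Over.pullback (Spec.map s)).obj Y)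
    (CoJetHom.baseChange (p := (twist s' e').map p ≫ c) ν' s) s (pullback.fst Y.hom (Spec.map s))
    pullback.condition (pullback_map_fst ((twist s' e').map p ≫ c))
    (twistSplit i j h₁ h₂ h₃ T).left h₄ rfl h₅).symm.trans ?_
  rw [CoJetHom.push_baseChange (p := (twist s' e').map p ≫ c)]
  have h₆ : baseChangeMap j h₁ T ≫ ((twist s' e').map p ≫ c).left =
      ((Over.pullback (Spec.map s'')).map p).left ≫ baseChangeMap j h₁ Z ≫ c.left :=
    (Category.assoc _ _ _).symm.trans ((congrArg (· ≫ c.left) hM).trans (Category.assoc _ _ _))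
  have h₇ : (((Over.pullback (Spec.map s'')).map p).left ≫ baseChangeMap j h₁ Z) ≫ c.left =
      ((Over.pullback (Spec.map s'')).map p).left ≫ baseChangeMap j h₁ Z ≫ c.left :=
    Category.assoc _ _ _
  refine (CoJetHom.comp_comp ν' _ rfl _ h₄ (twistSplit_fst i j h₁ h₂ h₃ T) h₆).trans ?_
  refine (CoJetHom.push_comp (Z := (Over.pullback (Spec.map s')).obj Z) (ν.baseChange s') e'
    c.left (Over.w c) rfl (baseChangeMap j h₁ T) h₆ hM h₇).trans ?_
  refine (congrArg (fun μ => CoJetHom.push μ e' c.left (Over.w c) h₇)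
    (CoJetHom.baseChange_push_baseChangeMap j h₁ ν rfl hM).symm).trans ?_
  exact CoJetHom.push_push (Z := (Over.pullback (Spec.map s')).obj Z) (ν.baseChange s'') _ _ _ _
    rfl rfl _ _

/-- On points, the interpolating map for `B''` is the composite of those for `B'` and `B`: the left
side is the value at `(p, ν)` of the interpolating map for `B'` followed by that for `B`. -/
theorem interpolationPoint_collapse (P : Prolongation s e X) (Q : Prolongation s' e' P.obj)
    (R : Prolongation s'' e'' X) (J : JetSpace m X) (i : B ⟶ B'') (j : B' ⟶ B'')
    (h₁ : s' ≫ j = s'') (h₂ : e' ≫ j = s ≫ i) (h₃ : e ≫ i = e'') {T : Over (Spec K)}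
    (p : T ⟶ Q.obj) (ν : CoJetHom m Q.obj p.left) :
    twistSplit i j h₁ h₂ h₃ T ≫ interpolationPoint P J ((twist s' e').map p ≫ Q.canonical)
        ((ν.baseChange s').push e' Q.canonical.left (Over.w Q.canonical) rfl) =
      interpolationPoint R J (p ≫ Prolongation.collapse P Q R i j h₁ h₂ h₃)
        (ν.push (𝟙 K) (Prolongation.collapse P Q R i j h₁ h₂ h₃).left (by simp) rfl) := by
  rw [interpolationPoint_push R J p _ ν
    (twist_map_comp_canonical_collapse P Q R i j h₁ h₂ h₃), interpolationPoint,
    JetSpace.comp_desc]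
  have hn : (twist s'' e'').map p ≫ twistSplit i j h₁ h₂ h₃ Q.obj ≫ (twist s e).map Q.canonical =
      twistSplit i j h₁ h₂ h₃ T ≫ (twist s e).map ((twist s' e').map p ≫ Q.canonical) := by
    rw [← Category.assoc, twistSplit_naturality, Category.assoc, ← Functor.map_comp]
  have hl := congrArg CommaMorphism.left hn
  have hs : (twistSplit i j h₁ h₂ h₃ Q.obj ≫ (twist s e).map Q.canonical).left ≫
      ((Over.pullback (Spec.map s)).obj P.obj).hom =
        ((Over.pullback (Spec.map s'')).obj Q.obj).hom ≫ Spec.map i := by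
    refine (Category.assoc _ _ _).trans ?_
    refine (congrArg (_ ≫ ·) (twist_map_snd Q.canonical)).trans ?_
    exact twistSplit_snd i j h₁ h₂ h₃ Q.obj
  have hn' : ((twist s'' e'').map p ≫ twistSplit i j h₁ h₂ h₃ Q.obj ≫
      (twist s e).map Q.canonical).left ≫ P.canonical.left =
      (twistSplit i j h₁ h₂ h₃ T ≫
        (twist s e).map ((twist s' e').map p ≫ Q.canonical) ≫ P.canonical).left := by
    rw [hn, ← Over.comp_left, Category.assoc]
  refine (congrArg (J.desc _) ((CoJetHom.push_comp _ e P.canonical.left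
    (Over.w P.canonical) rfl (twistSplit i j h₁ h₂ h₃ T).left rfl hl.symm hn').trans
    ((congrArg (fun μ => CoJetHom.push μ e P.canonical.left (Over.w P.canonical) hn')
      (CoJetHom.baseChange_baseChange i j h₁ h₂ h₃ ν Q.canonical hs rfl hl.symm)).trans
    (CoJetHom.push_push (ν.baseChange s'') hs rfl (Over.w P.canonical)
      hn' h₃ rfl (Over.w ((twistSplit i j h₁ h₂ h₃ Q.obj ≫ (twist s e).map Q.canonical) ≫
        P.canonical)) hn')))).trans ?_
  refine J.desc_push_congr _ ?_ rfl ?_ _ _ _ _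
  · rw [← Category.assoc, ← hn]; simp only [Category.assoc]
  · rw [← Over.comp_left, Category.assoc]

theorem interpolation_map (PX : Prolongation s e X) (PY : Prolongation s e Y)
    (JX : JetSpace m X) (JY : JetSpace m Y) (JPX : JetSpace m PX.obj) (JPY : JetSpace m PY.obj)
    (PJX : Prolongation s e JX.toOver) (PJY : Prolongation s e JY.toOver) (g : X ⟶ Y) :
    interpolation PX JPX JX PJX ≫ Prolongation.map PJX PJY (JX.map JY g) =
      JPX.map JPY (Prolongation.map PX PY g) ≫ interpolation PY JPY JY PJY := by
  refine JPX.hom_ext fun T p ν => (PJY.pointEquiv T).injective ?_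
  rw [← Category.assoc, Prolongation.pointEquiv_map, desc_interpolation, ← Category.assoc,
    JetSpace.desc_map, desc_interpolation]
  exact interpolationPoint_map PX JX PY JY g p ν

theorem interpolation_collapse (P : Prolongation s e X) (Q : Prolongation s' e' P.obj)
    (R : Prolongation s'' e'' X) (i : B ⟶ B'') (j : B' ⟶ B'')
    (h₁ : s' ≫ j = s'') (h₂ : e' ≫ j = s ≫ i) (h₃ : e ≫ i = e'')
    (JX : JetSpace m X) (JP : JetSpace m P.obj) (JQ : JetSpace m Q.obj) (JR : JetSpace m R.obj)
    (PJX : Prolongation s e JX.toOver) (QJP : Prolongation s' e' JP.toOver)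
    (QPJX : Prolongation s' e' PJX.obj) (RJX : Prolongation s'' e'' JX.toOver) :
    interpolation Q JQ JP QJP ≫ Prolongation.map QJP QPJX (interpolation P JP JX PJX) ≫
        Prolongation.collapse PJX QPJX RJX i j h₁ h₂ h₃ =
      JQ.map JR (Prolongation.collapse P Q R i j h₁ h₂ h₃) ≫ interpolation R JR JX RJX := by
  refine JQ.hom_ext fun T p ν => (RJX.pointEquiv T).injective ?_
  rw [← Category.assoc, ← Category.assoc, Prolongation.pointEquiv_collapse,
    Prolongation.pointEquiv_map, desc_interpolation, ← Category.assoc, JetSpace.desc_map,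
    desc_interpolation]
  refine (congrArg (twistSplit i j h₁ h₂ h₃ T ≫ ·) (desc_interpolation P JP JX PJX
    ((twist s' e').map p ≫ Q.canonical) _)).trans ?_
  exact interpolationPoint_collapse P Q R JX i j h₁ h₂ h₃ p ν

theorem interpolation_comparison (P : Prolongation s e X) (P' : Prolongation s' e' X)
    (α : B ⟶ B') (hs : s ≫ α = s') (he : e ≫ α = e')
    (JX : JetSpace m X) (JP : JetSpace m P.obj) (JP' : JetSpace m P'.obj)
    (PJX : Prolongation s e JX.toOver) (P'JX : Prolongation s' e' JX.toOver) :
    JP.map JP' (Prolongation.comparison P P' α hs he) ≫ interpolation P' JP' JX P'JX =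
      interpolation P JP JX PJX ≫ Prolongation.comparison PJX P'JX α hs he := by
  refine JP.hom_ext fun T p ν => (P'JX.pointEquiv T).injective ?_
  rw [← Category.assoc, JetSpace.desc_map, desc_interpolation, ← Category.assoc,
    Prolongation.pointEquiv_comparison, desc_interpolation]
  exact (interpolationPoint_comparison P P' JX α hs he p ν).symm

end Interpolations

/-- The identification `τ(τ(X, E, e), F, f) → τ(X, EF, ef)` is an isomorphism, since
`E(F(k)) = E(k) ⊗_k F(k)`. -/
theorem FiniteFreeAlgebraScheme.isIso_collapse {A : Type u} [CommRing A]
    {E F : FiniteFreeAlgebraScheme A} {k : CommAlgCat.{u} A}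
    {e : k ⟶ E.alg.obj k} {f : k ⟶ F.alg.obj k} {X : Over (Spec (base k))}
    (P : E.Prolongation e X) (Q : F.Prolongation f P.obj)
    (R : (E.comp F).Prolongation (compRing e f) X) : IsIso (collapse P Q R) :=
  Prolongation.isIso_collapse _ _ _ _ _ P Q R (E.isPushout f)

end Jets

theorem mainTheorem2 {A : Type u} [CommRing A] (k : CommAlgCat.{u} A)
    (E : FiniteFreeAlgebraScheme A) (e : k ⟶ E.alg.obj k) (m : ℕ) :
    (∀ (X Y : Over (Spec (base k))) (g : X ⟶ Y)
      (PX : E.Prolongation e X) (PY : E.Prolongation e Y)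
      (JX : JetSpace m X) (JY : JetSpace m Y)
      (JPX : JetSpace m PX.obj) (JPY : JetSpace m PY.obj)
      (PJX : E.Prolongation e JX.toOver) (PJY : E.Prolongation e JY.toOver),
      interpolation PX JPX JX PJX ≫ Jets.Prolongation.map PJX PJY (JX.map JY g) =
        JPX.map JPY (Jets.Prolongation.map PX PY g) ≫ interpolation PY JPY JY PJY) ∧
    (∀ (F : FiniteFreeAlgebraScheme A) (f : k ⟶ F.alg.obj k) (X : Over (Spec (base k)))
      (P : E.Prolongation e X) (Q : F.Prolongation f P.obj)
      (R : (E.comp F).Prolongation (compRing e f) X)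
      (JX : JetSpace m X) (JP : JetSpace m P.obj) (JQ : JetSpace m Q.obj) (JR : JetSpace m R.obj)
      (PJX : E.Prolongation e JX.toOver) (QJP : F.Prolongation f JP.toOver)
      (QPJX : F.Prolongation f PJX.obj)
      (RJX : (E.comp F).Prolongation (compRing e f) JX.toOver),
      IsIso (collapse P Q R) ∧ IsIso (collapse PJX QPJX RJX) ∧
        interpolation Q JQ JP QJP ≫
            Jets.Prolongation.map QJP QPJX (interpolation P JP JX PJX) ≫
            collapse PJX QPJX RJX =
          JQ.map JR (collapse P Q R) ≫ interpolation R JR JX RJX) ∧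
    (∀ (F : FiniteFreeAlgebraScheme A) (f : k ⟶ F.alg.obj k) (α : E.Hom F)
      (hα : E.ringHom e ≫ α.toNatTrans.app k = F.ringHom f) (X : Over (Spec (base k)))
      (P : E.Prolongation e X) (Q : F.Prolongation f X)
      (JX : JetSpace m X) (JP : JetSpace m P.obj) (JQ : JetSpace m Q.obj)
      (PJX : E.Prolongation e JX.toOver) (QJX : F.Prolongation f JX.toOver),
      JP.map JQ (comparison α hα P Q) ≫ interpolation Q JQ JX QJX =
        interpolation P JP JX PJX ≫ comparison α hα PJX QJX) :=
  ⟨fun _ _ g PX PY JX JY JPX JPY PJX PJY =>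
      interpolation_map PX PY JX JY JPX JPY PJX PJY g,
    fun _ _ _ P Q R JX JP JQ JR PJX QJP QPJX RJX =>
      ⟨FiniteFreeAlgebraScheme.isIso_collapse P Q R,
        FiniteFreeAlgebraScheme.isIso_collapse PJX QPJX RJX,
        interpolation_collapse P Q R _ _ _ _ _ JX JP JQ JR PJX QJP QPJX RJX⟩,
    fun _ _ _ _ _ P Q JX JP JQ PJX QJX =>
      interpolation_comparison P Q _ _ _ JX JP JQ PJX QJX⟩
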